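/- Let $\mathcal X=\{(x,y)\in\mathbb R^2: x<y\}$, $\overline{\mathcal X}=\{x\le y\}$, $\Delta=\{x=y\}$, with the metric $d_\infty((a,b),(c,d))=\max\{|a-c|,|b-d|\}$ on $\mathbb{R}^2$. For $\varepsilon>0$ and $x\in\mathbb R$ put $\Delta_\varepsilon^c=\{z\in\mathcal X: d_\infty(z,\Delta)\ge\varepsilon\}$ and $R_{x,\varepsilon}=\,]-\infty,x]\times[x+\varepsilon,\infty[$. For Borel measures $\mu,\nu$ on $\mathcal X$ let $\Gamma(\mu,\nu)$ be the set of Borel measures $\pi$ on $\overline{\mathcal X}^2$ with $\pi(A\times\overline{\mathcal X})=\mu(A)$ and $\pi(\overline{\mathcal X}\times A)=\nu(A)$ for all Borel $A\subset\mathcal X$ (no condition is imposed on the diagonal, which serves as a source of infinite mass). For $0<r<\infty$ let $$d_r(\mu,\nu)=\Big[\inf_{\pi\in\Gamma(\mu,\nu)}\int_{\overline{\mathcal X}^2} d_\infty(z,w)^r\,d\pi(z,w)\Big]^{1/r},$$ and let $\mathcal D_r$ be the set of Borel measures $\mu$ on $\mathcal X$ with $d_r(\mu,0)<\infty$, where $0$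 is the zero measure (the empty diagram). For $0<p<q<\infty$ put $\langle p,q\rangle=\{s\in\mathbb C:p<\operatorname{Re}s<q\}$. For $\mu\in\mathcal D_p\cap\mathcal D_q$, $x\in\mathbb R$ and $s\in\langle p,q\rangle$ define $$\zeta_\mu(s)=s\int_0^\infty\varepsilon^{s-1}\mu(\Delta_\varepsilon^c)\,d\varepsilon,\qquad \zeta_\mu^x(s)=s\int_0^\infty\varepsilon^{s-1}\mu(R_{x,\varepsilon})\,d\varepsilon .$$ Vague convergence $\mu_n\xrightarrow{v}\mu$ means $\int f\,d\mu_n\to\int f\,d\mu$ for every continuous $f:\mathcal X\to\mathbb R$ with compact support in $\mathcal X$. **Theorem.** Let $0<p<q<\infty$, let $(\mu_n)_{n}$ be a sequence in $\mathcal D_p\cap\mathcal D_q$ and let $\mu\in\mathcal D_p\cap\mathcal D_q$. Suppose that there is a function $g:\,]0,\infty[\,\to\mathbb R_+$ with $\mu_n(\Delta_\varepsilon^c)\le g(\varepsilon)$ for all $n$ and all $\varepsilon>0$, such that $g(\varepsilon)=O(\varepsilon^{-p})$ as $\varepsilon\to0$ and $g(\varepsilon)=O(\varepsilon^{-q})$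 as $\varepsilon\to\infty$. Then the following are equivalent: 1. There exists $r$ with $p<r<q$ such that $d_r(\mu_n,\mu)\to0$. 2. There exists $r$ with $p<r<q$ such that $\mu_n\xrightarrow{v}\mu$ and $\zeta_{\mu_n}(r)\to\zeta_\mu(r)$. 3. For almost every $(x,\varepsilon)\in\mathbb R\times\,]0,\infty[$ one has $\mu_n(\Delta_\varepsilon^c)\to\mu(\Delta_\varepsilon^c)$ and $\mu_n(R_{x,\varepsilon})\to\mu(R_{x,\varepsilon})$. 4. For almost every $x\in\mathbb R$, $\zeta^x_{\mu_n}\to\zeta^x_\mu$ and $\zeta_{\mu_n}\to\zeta_\mu$ uniformly on every compact subset of $\langle p,q\rangle$. 5. For all $r$ with $p<r<q$, $d_r(\mu_n,\mu)\to0$. -/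

import Mathlib

open Filter MeasureTheory Topology Asymptotics

noncomputable section

namespace Persistence

/-- The open half-plane above the diagonal. The plane `ℝ × ℝ` carries the sup metric. -/
def halfPlane : Set (ℝ × ℝ) := {z | z.1 < z.2}

/-- The closed half-plane, i.e. the open one together with the diagonal. -/
def closedHalfPlane : Set (ℝ × ℝ) := {z | z.1 ≤ z.2}

/-- The complement, in the open half-plane, of the open tubular neighbourhood of radius `ε`
(for the sup metric) of the diagonal. -/
def tail (ε : ℝ) : Set (ℝ × ℝ) := halfPlane \ Metric.thickening ε (Set.diagonal ℝ)

/-- The quadrant `]-∞, x] × [x + ε, ∞[`. -/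
def quadrant (x ε : ℝ) : Set (ℝ × ℝ) := Set.Iic x ×ˢ Set.Ici (x + ε)

/-- Transport plans between two measures on the open half-plane, the diagonal being a source and
a sink of infinite mass: measures on the square of the closed half-plane whose marginals agree
with `μ` and `ν` off the diagonal, with no condition on the diagonal. -/
def transportPlans (μ ν : Measure (ℝ × ℝ)) : Set (Measure ((ℝ × ℝ) × (ℝ × ℝ))) :=
  {π | π (closedHalfPlane ×ˢ closedHalfPlane)ᶜ = 0 ∧
    (∀ A : Set (ℝ × ℝ), MeasurableSet A → A ⊆ halfPlane → π (Prod.fst ⁻¹' A) = μ A) ∧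
    (∀ B : Set (ℝ × ℝ), MeasurableSet B → B ⊆ halfPlane → π (Prod.snd ⁻¹' B) = ν B)}

/-- The Wasserstein `r`-distance between diagrams. -/
def wassersteinDist (r : ℝ) (μ ν : Measure (ℝ × ℝ)) : ENNReal :=
  (⨅ π ∈ transportPlans μ ν, ∫⁻ z, edist z.1 z.2 ^ r ∂π) ^ (1 / r)

/-- The distance to the empty diagram (only the diagonal), i.e. to the zero measure. -/
def pers (r : ℝ) (μ : Measure (ℝ × ℝ)) : ENNReal := wassersteinDist r μ 0

/-- The Borel measures on the open half-plane (as measures on the plane that do not charge its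
complement) whose distance to the empty diagram is finite. -/
def persistenceSpace (r : ℝ) : Set (Measure (ℝ × ℝ)) :=
  {μ | μ halfPlaneᶜ = 0 ∧ pers r μ < ⊤}

/-- Vague convergence on the open half-plane: convergence against every continuous function with
compact support inside the open half-plane. -/
def VagueTendsto (μ : ℕ → Measure (ℝ × ℝ)) (ν : Measure (ℝ × ℝ)) : Prop :=
  ∀ f : ℝ × ℝ → ℝ, Continuous f → HasCompactSupport f → tsupport f ⊆ halfPlane →
    Tendsto (fun n => ∫ z, f z ∂(μ n)) atTop (𝓝 (∫ z, f z ∂ν))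

/-- The `ζ`-function: `s` times the Mellin transform of `ε ↦ μ (tail ε)`. -/
def zeta (μ : Measure (ℝ × ℝ)) (s : ℂ) : ℂ :=
  s * mellin (fun ε : ℝ => ((μ.real (tail ε) : ℝ) : ℂ)) s

/-- The local `ζ`-function at `x`: `s` times the Mellin transform of `ε ↦ μ (quadrant x ε)`. -/
def localZeta (μ : Measure (ℝ × ℝ)) (x : ℝ) (s : ℂ) : ℂ :=
  s * mellin (fun ε : ℝ => ((μ.real (quadrant x ε) : ℝ) : ℂ)) s

/-- The open vertical strip `p < Re s < q`. -/
def strip (p q : ℝ) : Set ℂ := {s | p < s.re ∧ s.re < q}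

end Persistence

end

/-!
Every `μ` in question satisfies `μ (tail ε) ≤ C * min (ε ^ (-p)) (ε ^ (-q))` with a common `C`
(`TailBound.of_isBigO`, `TailBound.of_mem`). Consequently all the energies `∫ gap ^ s dμ`, where
`gap` is the distance to the diagonal and `p < s < q`, are bounded uniformly
(`TailBound.exists_energy_le`), and `ζ_μ` equals the energy on the real axis (`zeta_ofReal`). Once
no energy of one exponent escapes, none of any other exponent in `]p, q[` does: this is what makes
the exponent `r` irrelevant.

Wasserstein convergence gives the vague convergence and the convergence of the energies by
integrating a modulus of continuity against nearly optimal plans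
(`EnergyControlled.tendsto_integral`). It also gives the convergence of the masses of tails and
quadrants, because these are superlevel sets of 1-Lipschitz functions, whose level sets are null for
almost all parameters (`tendsto_measure_superlevel`).

Pointwise convergence of the masses gives uniform convergence of the Mellin transforms on compact
sets by dominated convergence (`TailLike.tendstoUniformlyOn_mellin`). In the other direction, the
Mellin transform on a vertical line is a Fourier transform, so its pointwise convergence implies
convergence as distributions, which for monotone functions is convergence at the continuity points
of the limit (`TailLike.exists_countable_tendsto`). This yields convergence of the masses of a dense
family of quadrants, hence of half-open rectangles, and test functions are approximated by step
functions on such rectangles (`vagueTendsto_of_tendsto_corner`).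

Finally, vague convergence together with convergence of one energy implies Wasserstein convergence
for all exponents (`tendsto_cost_of_vagueTendsto`). A partition of unity on a compact set, subordinate
to balls that are small compared with their distance to the diagonal, cuts both measures into cells.
Inside a cell the common mass is coupled by a product measure; the surplus, which tends to `0`, and
everything outside the cells, whose energy is small, is sent to the diagonal
(`cost_le_of_partition`).
-/

namespace Persistence

/-! ### The gap function, transport plans and tail bounds -/

/-- The sup-distance from a point of the closed half-plane to the diagonal, extended by `0` to the rest
of the plane, so that its positive powers are continuous on the whole plane and vanish exactly off
`halfPlane`. -/
noncomputable def gap (z : ℝ × ℝ) : ℝ := max ((z.2 - z.1) / 2) 0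

lemma gap_nonneg (z : ℝ × ℝ) : 0 ≤ gap z := le_max_right _ _

@[fun_prop]
lemma continuous_gap : Continuous gap := by unfold gap; fun_prop

lemma gap_pos_iff {z : ℝ × ℝ} : 0 < gap z ↔ z ∈ halfPlane := by
  simp [gap, halfPlane]

lemma gap_eq_zero {z : ℝ × ℝ} (hz : z ∉ halfPlane) : gap z = 0 :=
  le_antisymm (not_lt.1 (mt gap_pos_iff.1 hz)) (gap_nonneg z)

lemma isOpen_halfPlane : IsOpen halfPlane := isOpen_lt continuous_fst continuous_snd

lemma measurableSet_halfPlane : MeasurableSet halfPlane := isOpen_halfPlane.measurableSet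

lemma abs_gap_sub_le (z w : ℝ × ℝ) : |gap z - gap w| ≤ dist z w := by
  have h1 : |z.1 - w.1| ≤ dist z w := by
    rw [Prod.dist_eq, ← Real.dist_eq]; exact le_max_left _ _
  have h2 : |z.2 - w.2| ≤ dist z w := by
    rw [Prod.dist_eq, ← Real.dist_eq]; exact le_max_right _ _
  refine (abs_max_sub_max_le_abs _ _ _).trans ?_
  rw [abs_le] at *
  constructor <;> linarith

lemma measurableSet_closedHalfPlane : MeasurableSet closedHalfPlane :=
  (isClosed_le continuous_fst continuous_snd).measurableSet

lemma tail_eq {ε : ℝ} (hε : 0 < ε) : tail ε = {z | ε ≤ gap z} := by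
  ext z
  simp only [tail, Set.mem_sdiff, Set.mem_ofPred_eq, Metric.mem_thickening_iff]
  constructor
  · rintro ⟨hz, h⟩
    by_contra! hlt
    have hz' : z.1 < z.2 := hz
    have h1 : (z.2 - z.1) / 2 < ε := (le_max_left _ _).trans_lt hlt
    refine h ⟨((z.1 + z.2) / 2, (z.1 + z.2) / 2), by simp [Set.diagonal], ?_⟩
    rw [Prod.dist_eq, max_lt_iff, Real.dist_eq, Real.dist_eq, abs_lt, abs_lt]
    refine ⟨⟨?_, ?_⟩, ?_, ?_⟩ <;> dsimp only <;> linarith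
  · intro h
    refine ⟨gap_pos_iff.1 (hε.trans_le h), ?_⟩
    rintro ⟨w, hw, hd⟩
    have hw' : w ∉ halfPlane := by
      have : w.1 = w.2 := hw
      simp [halfPlane, this]
    have := (le_abs_self _).trans (abs_gap_sub_le z w)
    rw [gap_eq_zero hw'] at this
    linarith

lemma tail_subset_halfPlane (ε : ℝ) : tail ε ⊆ halfPlane := Set.sdiff_subset

lemma tail_anti {ε δ : ℝ} (h : ε ≤ δ) : tail δ ⊆ tail ε :=
  Set.sdiff_subset_sdiff_right (Metric.thickening_mono h _)

lemma quadrant_subset_tail {ε : ℝ} (hε : 0 < ε) (x : ℝ) : quadrant x ε ⊆ tail (ε / 2) := by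
  rw [tail_eq (half_pos hε)]
  rintro z ⟨h1, h2⟩
  simp only [Set.mem_Iic, Set.mem_Ici] at h1 h2
  refine le_max_of_le_left (?_ : ε / 2 ≤ (z.2 - z.1) / 2)
  linarith

/-- A nearest point of the diagonal for the sup metric. -/
noncomputable def diagProj (z : ℝ × ℝ) : ℝ × ℝ := ((z.1 + z.2) / 2, (z.1 + z.2) / 2)

lemma diagProj_notMem (z : ℝ × ℝ) : diagProj z ∉ halfPlane := by simp [diagProj, halfPlane]

lemma diagProj_mem_closed (z : ℝ × ℝ) : diagProj z ∈ closedHalfPlane := by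
  simp [diagProj, closedHalfPlane]

@[fun_prop]
lemma continuous_diagProj : Continuous diagProj := by unfold diagProj; fun_prop

lemma halfPlane_subset_closed : halfPlane ⊆ closedHalfPlane := fun z hz =>
  le_of_lt (show z.1 < z.2 from hz)

lemma dist_diagProj {z : ℝ × ℝ} (hz : z ∈ halfPlane) : dist z (diagProj z) = gap z := by
  have hz' : z.1 < z.2 := hz
  have e : gap z = (z.2 - z.1) / 2 := max_eq_left (by linarith)
  rw [Prod.dist_eq, Real.dist_eq, Real.dist_eq, e]
  have h1 : z.1 - (diagProj z).1 = -((z.2 - z.1) / 2) := by simp only [diagProj]; ring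
  have h2 : z.2 - (diagProj z).2 = (z.2 - z.1) / 2 := by simp only [diagProj]; ring
  rw [h1, h2, abs_neg, max_self, abs_of_pos (by linarith)]

lemma edist_rpow {r : ℝ} (hr : 0 ≤ r) (z w : ℝ × ℝ) :
    edist z w ^ r = ENNReal.ofReal (dist z w ^ r) := by
  rw [edist_dist, ENNReal.ofReal_rpow_of_nonneg dist_nonneg hr]

/-- The total persistence of exponent `r`: the integral of the `r`-th power of the distance to the
diagonal. -/
noncomputable def energy (r : ℝ) (μ : Measure (ℝ × ℝ)) : ENNReal := ∫⁻ z, ENNReal.ofReal (gap z ^ r) ∂μ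

/-- The optimal transport cost between two diagrams, that is, `wassersteinDist r μ ν ^ r`.
Unlike the distance, it is subadditive in the pair `(μ, ν)` for every exponent. -/
noncomputable def cost (r : ℝ) (μ ν : Measure (ℝ × ℝ)) : ENNReal :=
  ⨅ π ∈ transportPlans μ ν, ∫⁻ z, edist z.1 z.2 ^ r ∂π

lemma tendsto_cost_iff {r : ℝ} (hr : 0 < r) (μn : ℕ → Measure (ℝ × ℝ)) (μ : Measure (ℝ × ℝ)) :
    Tendsto (fun n => wassersteinDist r (μn n) μ) atTop (𝓝 0) ↔
      Tendsto (fun n => cost r (μn n) μ) atTop (𝓝 0) := by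
  constructor <;> intro h
  · have := ((ENNReal.continuous_rpow_const (y := r)).tendsto 0).comp h
    rw [ENNReal.zero_rpow_of_pos hr] at this
    refine this.congr fun n => ?_
    simp only [Function.comp, wassersteinDist]
    rw [← ENNReal.rpow_mul, one_div_mul_cancel hr.ne', ENNReal.rpow_one]; rfl
  · have := ((ENNReal.continuous_rpow_const (y := 1 / r)).tendsto 0).comp h
    rw [ENNReal.zero_rpow_of_pos (by positivity)] at this
    exact this

section Plans

variable {μ ν : Measure (ℝ × ℝ)} {π : Measure ((ℝ × ℝ) × (ℝ × ℝ))}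

/-- A plan has the prescribed first marginal off the diagonal; hence the first coordinate transports
integrals of functions that vanish off the open half-plane (`lintegral_fst`, `integral_fst`). -/
lemma map_fst_restrict (hπ : π ∈ transportPlans μ ν) :
    (π.map Prod.fst).restrict halfPlane = μ.restrict halfPlane := by
  ext A hA
  rw [Measure.restrict_apply hA, Measure.restrict_apply hA,
    Measure.map_apply measurable_fst (hA.inter measurableSet_halfPlane)]
  exact hπ.2.1 _ (hA.inter measurableSet_halfPlane) Set.inter_subset_right

lemma map_snd_restrict (hπ : π ∈ transportPlans μ ν) :
    (π.map Prod.snd).restrict halfPlane = ν.restrict halfPlane := by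
  ext A hA
  rw [Measure.restrict_apply hA, Measure.restrict_apply hA,
    Measure.map_apply measurable_snd (hA.inter measurableSet_halfPlane)]
  exact hπ.2.2 _ (hA.inter measurableSet_halfPlane) Set.inter_subset_right

lemma lintegral_eq_of_restrict_eq {ρ σ : Measure (ℝ × ℝ)}
    (h : ρ.restrict halfPlane = σ.restrict halfPlane) {F : ℝ × ℝ → ENNReal}
    (hF : ∀ z ∉ halfPlane, F z = 0) : ∫⁻ z, F z ∂ρ = ∫⁻ z, F z ∂σ := by
  have hs : Function.support F ⊆ halfPlane := fun z hz => by_contra fun hz' => hz (hF z hz')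
  rw [← setLIntegral_eq_of_support_subset hs, h, setLIntegral_eq_of_support_subset hs]

lemma integral_eq_of_restrict_eq {ρ σ : Measure (ℝ × ℝ)}
    (h : ρ.restrict halfPlane = σ.restrict halfPlane) {f : ℝ × ℝ → ℝ}
    (hf : ∀ z ∉ halfPlane, f z = 0) : ∫ z, f z ∂ρ = ∫ z, f z ∂σ := by
  rw [← setIntegral_eq_integral_of_forall_compl_eq_zero hf, h,
    setIntegral_eq_integral_of_forall_compl_eq_zero hf]

lemma lintegral_fst (hπ : π ∈ transportPlans μ ν) {F : ℝ × ℝ → ENNReal} (hm : Measurable F)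
    (hF : ∀ z ∉ halfPlane, F z = 0) : ∫⁻ z, F z.1 ∂π = ∫⁻ z, F z ∂μ := by
  rw [← lintegral_eq_of_restrict_eq (map_fst_restrict hπ) hF, lintegral_map hm measurable_fst]

lemma lintegral_snd (hπ : π ∈ transportPlans μ ν) {F : ℝ × ℝ → ENNReal} (hm : Measurable F)
    (hF : ∀ z ∉ halfPlane, F z = 0) : ∫⁻ z, F z.2 ∂π = ∫⁻ z, F z ∂ν := by
  rw [← lintegral_eq_of_restrict_eq (map_snd_restrict hπ) hF, lintegral_map hm measurable_snd]

lemma integral_fst (hπ : π ∈ transportPlans μ ν) {f : ℝ × ℝ → ℝ} (hm : Measurable f)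
    (hf : ∀ z ∉ halfPlane, f z = 0) : ∫ z, f z.1 ∂π = ∫ z, f z ∂μ := by
  rw [← integral_eq_of_restrict_eq (map_fst_restrict hπ) hf,
    integral_map measurable_fst.aemeasurable hm.aestronglyMeasurable]

lemma integral_snd (hπ : π ∈ transportPlans μ ν) {f : ℝ × ℝ → ℝ} (hm : Measurable f)
    (hf : ∀ z ∉ halfPlane, f z = 0) : ∫ z, f z.2 ∂π = ∫ z, f z ∂ν := by
  rw [← integral_eq_of_restrict_eq (map_snd_restrict hπ) hf,
    integral_map measurable_snd.aemeasurable hm.aestronglyMeasurable]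

end Plans

lemma measurable_gap_rpow (r : ℝ) : Measurable fun z => ENNReal.ofReal (gap z ^ r) := by
  have := continuous_gap.measurable
  fun_prop

lemma gap_rpow_eq_zero {r : ℝ} (hr : 0 < r) {z : ℝ × ℝ} (hz : z ∉ halfPlane) : gap z ^ r = 0 := by
  rw [gap_eq_zero hz, Real.zero_rpow hr.ne']

/-- A plan from `μ` to the empty diagram ends on the diagonal, so it moves every point `z` by at
least `gap z`. -/
lemma energy_lt_top {r : ℝ} (hr : 0 < r) {μ : Measure (ℝ × ℝ)} (hμ : μ ∈ persistenceSpace r) :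
    energy r μ < ⊤ := by
  have h : cost r μ 0 < ⊤ := by
    have := hμ.2
    rw [pers, wassersteinDist, ENNReal.rpow_lt_top_iff_of_pos (by positivity)] at this
    exact this
  simp only [cost, iInf_lt_iff] at h
  obtain ⟨π, hπ, hlt⟩ := h
  refine lt_of_le_of_lt ?_ hlt
  rw [energy, ← lintegral_fst hπ (measurable_gap_rpow r)
    (fun z hz => by simp [gap_rpow_eq_zero hr hz])]
  refine lintegral_mono_ae ?_
  have h2 : ∀ᵐ z ∂π, z.2 ∉ halfPlane := by
    have := hπ.2.2 _ measurableSet_halfPlane subset_rfl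
    rw [ae_iff]
    simpa [Set.preimage] using this
  filter_upwards [h2] with z hz
  rw [edist_rpow hr.le]
  have := (le_abs_self _).trans (abs_gap_sub_le z.1 z.2)
  rw [gap_eq_zero hz, sub_zero] at this
  gcongr
  exact gap_nonneg _

/-- Layer-cake formula. -/
lemma energy_eq_lintegral_tail {r : ℝ} (hr : 0 < r) (μ : Measure (ℝ × ℝ)) :
    energy r μ =
      ENNReal.ofReal r * ∫⁻ t in Set.Ioi 0, μ (tail t) * ENNReal.ofReal (t ^ (r - 1)) := by
  rw [energy, lintegral_rpow_eq_lintegral_meas_le_mul μ (ae_of_all _ gap_nonneg)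
    continuous_gap.measurable.aemeasurable hr]
  congr 1
  refine setLIntegral_congr_fun measurableSet_Ioi fun t ht => ?_
  simp only [tail_eq ht]

/-- Domination of the tail function by `C * min (ε ^ (-p)) (ε ^ (-q))`; for `p < q` this is the
bound `C ε ^ (-p)` near `0` and `C ε ^ (-q)` near infinity. -/
def TailBound (p q C : ℝ) (μ : Measure (ℝ × ℝ)) : Prop :=
  ∀ ε, 0 < ε → μ (tail ε) ≤ ENNReal.ofReal (C * min (ε ^ (-p)) (ε ^ (-q)))

lemma TailBound.lt_top {p q C : ℝ} {μ : Measure (ℝ × ℝ)} (h : TailBound p q C μ) {ε : ℝ}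
    (hε : 0 < ε) : μ (tail ε) < ⊤ := (h ε hε).trans_lt ENNReal.ofReal_lt_top

lemma TailBound.mono {p q C C' : ℝ} {μ : Measure (ℝ × ℝ)} (h : TailBound p q C μ) (hC : C ≤ C') :
    TailBound p q C' μ := fun ε hε => (h ε hε).trans <| by gcongr

/-- Markov's inequality. -/
lemma meas_tail_le_energy {r : ℝ} (hr : 0 < r) (μ : Measure (ℝ × ℝ)) (h : energy r μ < ⊤)
    {ε : ℝ} (hε : 0 < ε) : μ (tail ε) ≤ ENNReal.ofReal ((energy r μ).toReal * ε ^ (-r)) := by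
  rw [ENNReal.ofReal_mul ENNReal.toReal_nonneg, ENNReal.ofReal_toReal h.ne, Real.rpow_neg hε.le,
    ENNReal.ofReal_inv_of_pos (by positivity), ← div_eq_mul_inv]
  refine le_trans (measure_mono ?_) (meas_ge_le_lintegral_div (measurable_gap_rpow r).aemeasurable
    (by simp; positivity) ENNReal.ofReal_ne_top)
  rw [tail_eq hε]
  intro z hz
  simp only [Set.mem_ofPred_eq] at hz ⊢
  gcongr

lemma TailBound.of_mem {p q : ℝ} (hp : 0 < p) (hpq : p < q) {μ : Measure (ℝ × ℝ)}
    (hμ : μ ∈ persistenceSpace p ∩ persistenceSpace q) : ∃ C, TailBound p q C μ := by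
  have hq := hp.trans hpq
  refine ⟨max (energy p μ).toReal (energy q μ).toReal, fun ε hε => ?_⟩
  rw [mul_min_of_nonneg _ _ (le_max_of_le_left ENNReal.toReal_nonneg), ENNReal.ofReal_min, le_min_iff]
  constructor
  · refine (meas_tail_le_energy hp μ (energy_lt_top hp hμ.1) hε).trans ?_
    gcongr; exact le_max_left _ _
  · refine (meas_tail_le_energy hq μ (energy_lt_top hq hμ.2) hε).trans ?_
    gcongr; exact le_max_right _ _

/-- No regularity of `g` is needed: between the two asymptotic regimes the monotonicity of
`ε ↦ μ (tail ε)` bounds the tail by a single value of `g`. -/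
lemma TailBound.of_isBigO {p q : ℝ} (hp : 0 < p) (hpq : p < q) {g : ℝ → ℝ}
    (hg_zero : g =O[𝓝[>] (0 : ℝ)] fun ε => ε ^ (-p))
    (hg_top : g =O[atTop] fun ε => ε ^ (-q)) :
    ∃ C, ∀ μ : Measure (ℝ × ℝ), (∀ ε, 0 < ε → μ (tail ε) ≤ ENNReal.ofReal (g ε)) →
      TailBound p q C μ := by
  have hq := hp.trans hpq
  obtain ⟨c, hc, h0⟩ := hg_zero.exists_pos
  obtain ⟨d, hd, h1⟩ := hg_top.exists_pos
  obtain ⟨η, hη, h0⟩ := mem_nhdsGT_iff_exists_Ioo_subset.1 h0.bound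
  obtain ⟨L, h1⟩ := eventually_atTop.1 h1.bound
  have hη' : (0 : ℝ) < η := hη
  -- On `[a, b]`, between the two asymptotic regimes, the tail is at most `g a` by monotonicity.
  set a := min (η / 2) 1 with ha
  set b := max L 1 with hb
  have ha0 : 0 < a := by positivity
  have ha1 : a ≤ 1 := min_le_right _ _
  have hb1 : 1 ≤ b := le_max_right _ _
  have hbq : (0 : ℝ) < b ^ q := by positivity
  refine ⟨max c d + max (g a) 0 * b ^ q, fun μ hμ ε hε => ?_⟩
  have hB : 0 ≤ max (g a) 0 * b ^ q := by positivity
  have hcd : 0 < max c d := by positivity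
  rcases lt_or_ge ε a with h | h
  · have hm : ε ∈ Set.Ioo 0 η := ⟨hε, by
      have := min_le_left (η / 2) 1
      linarith⟩
    have hb := h0 hm
    simp only [Set.mem_ofPred_eq, Real.norm_eq_abs] at hb
    rw [abs_of_nonneg (Real.rpow_nonneg hε.le _)] at hb
    have : ε ^ (-p) ≤ ε ^ (-q) :=
      Real.rpow_le_rpow_of_exponent_ge hε (h.le.trans ha1) (by linarith)
    rw [min_eq_left this]
    refine (hμ ε hε).trans (ENNReal.ofReal_le_ofReal ((le_abs_self _).trans (hb.trans ?_)))
    gcongr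
    linarith [le_max_left c d]
  rcases le_or_gt ε b with h' | h'
  · refine (measure_mono (tail_anti h)).trans ((hμ a ha0).trans (ENNReal.ofReal_le_ofReal ?_))
    have hb0 : 0 < b := by linarith
    have : b ^ (-q) ≤ min (ε ^ (-p)) (ε ^ (-q)) := by
      refine le_min ?_ ?_
      · exact (Real.rpow_le_rpow_of_exponent_le hb1 (by linarith)).trans
          (Real.rpow_le_rpow_of_nonpos hε h' (by linarith))
      · exact Real.rpow_le_rpow_of_nonpos hε h' (by linarith)
    calc g a ≤ max (g a) 0 := le_max_left _ _
      _ = max (g a) 0 * b ^ q * b ^ (-q) := by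
          rw [mul_assoc, ← Real.rpow_add hb0]; simp
      _ ≤ max (g a) 0 * b ^ q * min (ε ^ (-p)) (ε ^ (-q)) := by gcongr
      _ ≤ _ := by
          gcongr
          linarith
  · have hb2 := h1 ε ((le_max_left L 1).trans h'.le)
    simp only [Real.norm_eq_abs] at hb2
    rw [abs_of_nonneg (Real.rpow_nonneg hε.le _)] at hb2
    have : ε ^ (-q) ≤ ε ^ (-p) :=
      Real.rpow_le_rpow_of_exponent_le (hb1.trans h'.le) (by linarith)
    rw [min_eq_right this]
    refine (hμ ε hε).trans (ENNReal.ofReal_le_ofReal ((le_abs_self _).trans (hb2.trans ?_)))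
    gcongr
    linarith [le_max_right c d]

lemma integrableOn_min_rpow {p q r : ℝ} (hpr : p < r) (hrq : r < q) :
    IntegrableOn (fun t : ℝ => t ^ (r - 1) * min (t ^ (-p)) (t ^ (-q))) (Set.Ioi 0) := by
  rw [← Set.Ioc_union_Ioi_eq_Ioi zero_le_one, integrableOn_union]
  have hm : AEStronglyMeasurable (fun t : ℝ => t ^ (r - 1) * min (t ^ (-p)) (t ^ (-q))) := by
    refine (Measurable.aestronglyMeasurable ?_)
    fun_prop
  constructor
  · have : IntegrableOn (fun t : ℝ => t ^ (r - 1 - p)) (Set.Ioc 0 1) := by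
      rw [← intervalIntegrable_iff_integrableOn_Ioc_of_le zero_le_one]
      exact intervalIntegral.intervalIntegrable_rpow' (by linarith)
    refine this.mono' hm.restrict ?_
    filter_upwards [ae_restrict_mem measurableSet_Ioc] with t ht
    have h0 : 0 < t := ht.1
    rw [Real.norm_of_nonneg (by positivity), sub_eq_add_neg _ p, Real.rpow_add h0]
    gcongr
    exact min_le_left _ _
  · have : IntegrableOn (fun t : ℝ => t ^ (r - 1 - q)) (Set.Ioi 1) :=
      integrableOn_Ioi_rpow_of_lt (by linarith) one_pos
    refine this.mono' hm.restrict ?_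
    filter_upwards [ae_restrict_mem measurableSet_Ioi] with t ht
    have h0 : 0 < t := one_pos.trans ht
    rw [Real.norm_of_nonneg (by positivity), sub_eq_add_neg _ q, Real.rpow_add h0]
    gcongr
    exact min_le_right _ _

/-- All energies of exponent strictly between `p` and `q` are bounded uniformly over the measures
satisfying a given tail bound. -/
lemma TailBound.exists_energy_le {p q r : ℝ} (hp : 0 < p) (hpr : p < r) (hrq : r < q) (C : ℝ) :
    ∃ M : ENNReal, M ≠ ⊤ ∧ ∀ μ, TailBound p q C μ → energy r μ ≤ M := by
  have hr := hp.trans hpr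
  refine ⟨ENNReal.ofReal r * ∫⁻ t in Set.Ioi 0,
    ENNReal.ofReal (max C 0 * (t ^ (r - 1) * min (t ^ (-p)) (t ^ (-q)))),
    ENNReal.mul_ne_top ENNReal.ofReal_ne_top ?_, fun μ hμ => ?_⟩
  · exact ((integrableOn_min_rpow hpr hrq).const_mul _).lintegral_lt_top.ne
  · rw [energy_eq_lintegral_tail hr]
    gcongr ENNReal.ofReal r * ?_
    refine setLIntegral_mono_ae' measurableSet_Ioi (ae_of_all _ fun t ht => ?_)
    have h0 : (0 : ℝ) < t := ht
    refine (mul_le_mul_left (hμ.mono (le_max_left C 0) t ht) _).trans ?_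
    rw [← ENNReal.ofReal_mul (by positivity)]
    apply le_of_eq
    congr 1; ring

/-- On the real axis the `ζ`-function is the energy. -/
lemma zeta_ofReal {p q r C : ℝ} (hp : 0 < p) (hpr : p < r) {μ : Measure (ℝ × ℝ)}
    (hμ : TailBound p q C μ) : zeta μ r = ((energy r μ).toReal : ℂ) := by
  have hr := hp.trans hpr
  rw [energy_eq_lintegral_tail hr, ENNReal.toReal_mul, ENNReal.toReal_ofReal hr.le, zeta, mellin]
  push_cast
  congr 1
  have h1 : ∫ t in Set.Ioi (0 : ℝ), (t : ℂ) ^ ((r : ℂ) - 1) • ((μ.real (tail t) : ℝ) : ℂ) =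
      ∫ t in Set.Ioi (0 : ℝ), ((t ^ (r - 1) * μ.real (tail t) : ℝ) : ℂ) := by
    refine setIntegral_congr_fun measurableSet_Ioi fun t ht => ?_
    have h0 : (0 : ℝ) < t := ht
    simp only [smul_eq_mul, Complex.ofReal_mul]
    rw [Complex.ofReal_cpow h0.le]
    push_cast; rfl
  have hm : AEMeasurable (fun t => μ (tail t)) (volume.restrict (Set.Ioi (0 : ℝ))) :=
    aemeasurable_restrict_of_antitoneOn measurableSet_Ioi
      fun s _ t _ hst => measure_mono (tail_anti hst)
  rw [h1, integral_complex_ofReal, integral_eq_lintegral_of_nonneg_ae]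
  · congr 2
    refine setLIntegral_congr_fun measurableSet_Ioi fun t ht => ?_
    have h0 : (0 : ℝ) < t := ht
    rw [ENNReal.ofReal_mul (by positivity), ofReal_measureReal (hμ.lt_top h0).ne, mul_comm]
  · filter_upwards [ae_restrict_mem measurableSet_Ioi] with t ht
    have h0 : (0 : ℝ) < t := ht
    simp only [Pi.zero_apply]; positivity
  · have : AEMeasurable (fun t => t ^ (r - 1) * μ.real (tail t))
        (volume.restrict (Set.Ioi (0 : ℝ))) := by
      refine AEMeasurable.mul (by fun_prop) hm.ennreal_toReal
    exact this.aestronglyMeasurable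

/-! ### Wasserstein convergence controls integrals -/

/-- A modulus of continuity for `f` adapted to transport plans: integrating it against a plan bounds
the change of `∫ f` by a small multiple of the energies plus a multiple of the transport cost. -/
def EnergyControlled (r : ℝ) (f : ℝ × ℝ → ℝ) : Prop :=
  ∀ δ, 0 < δ → ∃ C, 0 ≤ C ∧ ∀ z w, |f z - f w| ≤ δ * (gap z ^ r + gap w ^ r) + C * dist z w ^ r

lemma integrable_gap_rpow {r : ℝ} {μ : Measure (ℝ × ℝ)} (hμ : energy r μ < ⊤) :
    Integrable (fun z => gap z ^ r) μ := by
  have hm : Measurable fun z => gap z ^ r := by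
    have := continuous_gap.measurable
    fun_prop
  rw [← lintegral_ofReal_ne_top_iff_integrable hm.aestronglyMeasurable
    (ae_of_all _ fun z => Real.rpow_nonneg (gap_nonneg z) r)]
  exact hμ.ne

/-- Comparing `z` with its projection to the diagonal shows that `f` is dominated by a multiple of
`gap ^ r`. -/
lemma EnergyControlled.integrable {r : ℝ} (hr : 0 < r) {f : ℝ × ℝ → ℝ}
    (h : EnergyControlled r f) (hm : Measurable f) (h0 : ∀ z ∉ halfPlane, f z = 0)
    {μ : Measure (ℝ × ℝ)} (hμ : energy r μ < ⊤) : Integrable f μ := by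
  obtain ⟨C, hC, h⟩ := h 1 one_pos
  refine ((integrable_gap_rpow hμ).const_mul (1 + C)).mono' hm.aestronglyMeasurable
    (ae_of_all _ fun z => ?_)
  by_cases hz : z ∈ halfPlane
  · have := h z (diagProj z)
    rw [h0 _ (diagProj_notMem z), gap_rpow_eq_zero hr (diagProj_notMem z), dist_diagProj hz] at this
    simp only [sub_zero, add_zero] at this
    rw [Real.norm_eq_abs]
    linarith
  · rw [h0 z hz, gap_rpow_eq_zero hr hz]; simp

lemma edist_integral_le {r : ℝ} (hr : 0 < r) {f : ℝ × ℝ → ℝ} (hm : Measurable f)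
    (h0 : ∀ z ∉ halfPlane, f z = 0) {δ C : ℝ} (hδ : 0 < δ) (hC : 0 ≤ C)
    (hf : ∀ z w, |f z - f w| ≤ δ * (gap z ^ r + gap w ^ r) + C * dist z w ^ r)
    {μ ν : Measure (ℝ × ℝ)} (hμ : Integrable f μ) (hν : Integrable f ν)
    {π : Measure ((ℝ × ℝ) × (ℝ × ℝ))} (hπ : π ∈ transportPlans μ ν) :
    edist (∫ z, f z ∂μ) (∫ z, f z ∂ν) ≤ ENNReal.ofReal δ * (energy r μ + energy r ν) +
      ENNReal.ofReal C * ∫⁻ z, edist z.1 z.2 ^ r ∂π := by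
  have he : Measurable fun z => ‖f z‖ₑ := hm.enorm
  have h1 : Integrable (fun z => f z.1) π := by
    refine ⟨(hm.comp measurable_fst).aestronglyMeasurable, ?_⟩
    have := lintegral_fst hπ he (fun z hz => by simp [h0 z hz])
    rw [HasFiniteIntegral, this]
    exact hμ.2
  have h2 : Integrable (fun z => f z.2) π := by
    refine ⟨(hm.comp measurable_snd).aestronglyMeasurable, ?_⟩
    have := lintegral_snd hπ he (fun z hz => by simp [h0 z hz])
    rw [HasFiniteIntegral, this]
    exact hν.2
  have hg := measurable_gap_rpow r
  have hz : ∀ z ∉ halfPlane, ENNReal.ofReal (gap z ^ r) = 0 := fun z hz => by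
    simp [gap_rpow_eq_zero hr hz]
  rw [← integral_fst hπ hm h0, ← integral_snd hπ hm h0, edist_eq_enorm_sub, ← integral_sub h1 h2]
  refine (enorm_integral_le_lintegral_enorm _).trans ?_
  have hg1 : Measurable fun z : (ℝ × ℝ) × (ℝ × ℝ) => ENNReal.ofReal (gap z.1 ^ r) :=
    hg.comp measurable_fst
  have hg2 : Measurable fun z : (ℝ × ℝ) × (ℝ × ℝ) => ENNReal.ofReal (gap z.2 ^ r) :=
    hg.comp measurable_snd
  rw [energy, energy, ← lintegral_fst hπ hg hz, ← lintegral_snd hπ hg hz,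
    ← lintegral_add_left hg1, ← lintegral_const_mul' _ _ ENNReal.ofReal_ne_top,
    ← lintegral_const_mul' _ _ ENNReal.ofReal_ne_top, ← lintegral_add_left (by fun_prop)]
  refine lintegral_mono fun z => ?_
  have hz1 := Real.rpow_nonneg (gap_nonneg z.1) r
  have hz2 := Real.rpow_nonneg (gap_nonneg z.2) r
  rw [Real.enorm_eq_ofReal_abs, edist_rpow hr.le, ← ENNReal.ofReal_add hz1 hz2,
    ← ENNReal.ofReal_mul hδ.le, ← ENNReal.ofReal_mul hC, ← ENNReal.ofReal_add (by positivity)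
      (by positivity)]
  exact ENNReal.ofReal_le_ofReal (hf _ _)

lemma EnergyControlled.tendsto_integral {r : ℝ} (hr : 0 < r) {f : ℝ × ℝ → ℝ}
    (h : EnergyControlled r f) (hm : Measurable f) (h0 : ∀ z ∉ halfPlane, f z = 0)
    {μn : ℕ → Measure (ℝ × ℝ)} {μ : Measure (ℝ × ℝ)} {M : ENNReal} (hM : M ≠ ⊤)
    (hμn : ∀ n, energy r (μn n) ≤ M) (hμ : energy r μ ≤ M)
    (hc : Tendsto (fun n => cost r (μn n) μ) atTop (𝓝 0)) :
    Tendsto (fun n => ∫ z, f z ∂(μn n)) atTop (𝓝 (∫ z, f z ∂μ)) := by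
  refine Metric.tendsto_nhds.2 fun ε hε => ?_
  set m := M.toReal with hm'
  have hm0 : 0 ≤ m := ENNReal.toReal_nonneg
  set δ := ε / (4 * (m + 1)) with hδ
  have hδ0 : 0 < δ := by positivity
  obtain ⟨C, hC, hf⟩ := h δ hδ0
  have hev := (tendsto_order.1 hc).2 (ENNReal.ofReal (ε / (2 * (C + 1))))
    (by simp; positivity)
  filter_upwards [hev] with n hlt
  simp only [cost, iInf_lt_iff] at hlt
  obtain ⟨π, hπ, hlt⟩ := hlt
  have hMm : M = ENNReal.ofReal m := (ENNReal.ofReal_toReal hM).symm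
  rw [← edist_lt_ofReal]
  refine (edist_integral_le hr hm h0 hδ0 hC hf (h.integrable hr hm h0 ((hμn n).trans_lt hM.lt_top))
    (h.integrable hr hm h0 (hμ.trans_lt hM.lt_top)) hπ).trans_lt ?_
  calc _ ≤ ENNReal.ofReal δ * (ENNReal.ofReal m + ENNReal.ofReal m) +
        ENNReal.ofReal C * ENNReal.ofReal (ε / (2 * (C + 1))) := by
        rw [← hMm]
        gcongr
        · exact hμn n
    _ = ENNReal.ofReal (δ * (m + m) + C * (ε / (2 * (C + 1)))) := by
        rw [← ENNReal.ofReal_add hm0 hm0, ← ENNReal.ofReal_mul hδ0.le, ← ENNReal.ofReal_mul hC,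
          ← ENNReal.ofReal_add (by positivity) (by positivity)]
    _ < ENNReal.ofReal ε := by
        refine (ENNReal.ofReal_lt_ofReal_iff hε).2 ?_
        have e1 : δ * (m + m) < ε / 2 := by
          rw [hδ, div_mul_eq_mul_div, div_lt_iff₀ (by positivity)]
          nlinarith
        have e2 : C * (ε / (2 * (C + 1))) ≤ ε / 2 := by
          rw [mul_div_assoc', div_le_iff₀ (by positivity)]
          nlinarith
        linarith

/-- A substitute for Minkowski's inequality that is valid for all `r > 0`. -/
lemma abs_rpow_sub_rpow_le {r : ℝ} (hr : 0 < r) {δ : ℝ} (hδ : 0 < δ) :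
    ∃ C, 0 ≤ C ∧ ∀ a b : ℝ, 0 ≤ a → 0 ≤ b →
      |a ^ r - b ^ r| ≤ δ * (a ^ r + b ^ r) + C * |a - b| ^ r := by
  have hlim : Tendsto (fun θ : ℝ => (1 - θ) ^ r) (𝓝[>] 0) (𝓝 1) := by
    have : Continuous fun θ : ℝ => (1 - θ) ^ r := by
      exact (Real.continuous_rpow_const hr.le).comp (by fun_prop)
    have := this.tendsto 0
    simp only [sub_zero, Real.one_rpow] at this
    exact this.mono_left nhdsWithin_le_nhds
  obtain ⟨θ, hθ, hθ0, hθ1⟩ := ((hlim.eventually (lt_mem_nhds (show 1 - δ < 1 by linarith))).and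
    (Ioo_mem_nhdsGT one_pos)).exists
  -- Either `a - b` is at least the fraction `θ` of `a`, or `b` is so close to `a` that
  -- `a ^ r - b ^ r ≤ δ * a ^ r`.
  have key : ∀ a b : ℝ, 0 ≤ b → b ≤ a →
      a ^ r - b ^ r ≤ δ * (a ^ r + b ^ r) + (1 / θ) ^ r * (a - b) ^ r := by
    intro a b hb hab
    have ha := hb.trans hab
    have hbr := Real.rpow_nonneg hb r
    have har := Real.rpow_nonneg ha r
    rcases le_total (θ * a) (a - b) with h | h
    · have : a ^ r ≤ (1 / θ) ^ r * (a - b) ^ r := by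
        rw [← Real.mul_rpow (by positivity) (by linarith)]
        refine Real.rpow_le_rpow ha ?_ hr.le
        rw [one_div, ← div_eq_inv_mul, le_div_iff₀ hθ0]
        linarith
      nlinarith
    · have : (1 - θ) ^ r * a ^ r ≤ b ^ r := by
        rw [← Real.mul_rpow (by linarith) ha]
        exact Real.rpow_le_rpow (mul_nonneg (by linarith) ha) (by linarith) hr.le
      have h2 : 0 ≤ (1 / θ) ^ r * (a - b) ^ r :=
        mul_nonneg (by positivity) (Real.rpow_nonneg (by linarith) r)
      nlinarith
  refine ⟨(1 / θ) ^ r, by positivity, fun a b ha hb => ?_⟩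
  rcases le_total b a with h | h
  · have := Real.rpow_le_rpow hb h hr.le
    rw [abs_of_nonneg (by linarith), abs_of_nonneg (by linarith)]
    exact key a b hb h
  · have := Real.rpow_le_rpow ha h hr.le
    rw [abs_sub_comm, abs_sub_comm a b, abs_of_nonneg (by linarith), abs_of_nonneg (by linarith),
      add_comm (a ^ r)]
    exact key b a ha h

lemma energyControlled_gap_rpow {r : ℝ} (hr : 0 < r) :
    EnergyControlled r fun z => gap z ^ r := by
  intro δ hδ
  obtain ⟨C, hC, h⟩ := abs_rpow_sub_rpow_le hr hδ
  refine ⟨C, hC, fun z w => (h _ _ (gap_nonneg z) (gap_nonneg w)).trans ?_⟩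
  gcongr
  exact abs_gap_sub_le z w

lemma energyControlled_of_hasCompactSupport {r : ℝ} (hr : 0 < r) {f : ℝ × ℝ → ℝ}
    (hf : Continuous f) (hc : HasCompactSupport f) (hs : tsupport f ⊆ halfPlane) :
    EnergyControlled r f := by
  intro δ hδ
  -- `gap` is at least `c > 0` on the support, so small oscillations are absorbed by `gap ^ r`.
  obtain ⟨c, hc0, hcK⟩ := hc.isCompact.exists_forall_le' (f := gap) continuous_gap.continuousOn
    (a := 0) (fun z hz => gap_pos_iff.2 (hs hz))
  obtain ⟨B, hB⟩ := hf.bounded_above_of_compact_support hc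
  have hB0 : 0 ≤ B := (norm_nonneg _).trans (hB 0)
  have hω : 0 < δ * c ^ r := by positivity
  obtain ⟨d, hd, hunif⟩ := Metric.uniformContinuous_iff.1
    (hc.uniformContinuous_of_continuous hf) _ hω
  refine ⟨2 * B / d ^ r, by positivity, fun z w => ?_⟩
  have hz1 := Real.rpow_nonneg (gap_nonneg z) r
  have hw1 := Real.rpow_nonneg (gap_nonneg w) r
  have hdist : 0 ≤ 2 * B / d ^ r * dist z w ^ r := by positivity
  have hsupp : ∀ z, f z ≠ 0 → δ * c ^ r ≤ δ * gap z ^ r := fun z hz => by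
    have := hcK z (subset_tsupport f hz)
    gcongr
  rcases lt_or_ge (dist z w) d with h | h
  · have h1 := hunif h
    rw [Real.dist_eq] at h1
    by_cases hz : f z = 0
    · by_cases hw : f w = 0
      · rw [hz, hw, sub_zero, abs_zero]; positivity
      · have := hsupp w hw
        nlinarith
    · have := hsupp z hz
      nlinarith
  · have h1 : |f z - f w| ≤ 2 * B := by
      have h2 := hB z
      have h3 := hB w
      rw [Real.norm_eq_abs] at h2 h3
      linarith [abs_sub (f z) (f w)]
    have h2 : 2 * B ≤ 2 * B / d ^ r * dist z w ^ r := by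
      rw [div_mul_eq_mul_div, le_div_iff₀ (by positivity)]
      gcongr
    nlinarith

lemma integral_gap_rpow {r : ℝ} (μ : Measure (ℝ × ℝ)) :
    ∫ z, gap z ^ r ∂μ = (energy r μ).toReal := by
  have hm : Measurable fun z => gap z ^ r := by
    have := continuous_gap.measurable
    fun_prop
  rw [integral_eq_lintegral_of_nonneg_ae (ae_of_all _ fun z => Real.rpow_nonneg (gap_nonneg z) r)
    hm.aestronglyMeasurable, energy]

lemma tendsto_energy_of_tendsto_cost {r : ℝ} (hr : 0 < r)
    {μn : ℕ → Measure (ℝ × ℝ)} {μ : Measure (ℝ × ℝ)} {M : ENNReal} (hM : M ≠ ⊤)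
    (hμn : ∀ n, energy r (μn n) ≤ M) (hμ : energy r μ ≤ M)
    (hc : Tendsto (fun n => cost r (μn n) μ) atTop (𝓝 0)) :
    Tendsto (fun n => (energy r (μn n)).toReal) atTop (𝓝 (energy r μ).toReal) := by
  have hm : Measurable fun z => gap z ^ r := by
    have := continuous_gap.measurable
    fun_prop
  simpa only [integral_gap_rpow] using (energyControlled_gap_rpow hr).tendsto_integral hr hm
    (fun z hz => gap_rpow_eq_zero hr hz) hM hμn hμ hc

lemma eq_zero_of_notMem_halfPlane {f : ℝ × ℝ → ℝ} (hs : tsupport f ⊆ halfPlane) :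
    ∀ z ∉ halfPlane, f z = 0 := fun _ hz => image_eq_zero_of_notMem_tsupport fun h => hz (hs h)

lemma vagueTendsto_of_tendsto_cost {r : ℝ} (hr : 0 < r)
    {μn : ℕ → Measure (ℝ × ℝ)} {μ : Measure (ℝ × ℝ)} {M : ENNReal} (hM : M ≠ ⊤)
    (hμn : ∀ n, energy r (μn n) ≤ M) (hμ : energy r μ ≤ M)
    (hc : Tendsto (fun n => cost r (μn n) μ) atTop (𝓝 0)) : VagueTendsto μn μ :=
  fun _ hf hfc hfs => (energyControlled_of_hasCompactSupport hr hf hfc hfs).tendsto_integral hr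
    hf.measurable (eq_zero_of_notMem_halfPlane hfs) hM hμn hμ hc

/-! ### Wasserstein convergence controls masses of superlevel sets -/

lemma swap_mem_transportPlans {μ ν : Measure (ℝ × ℝ)} {π : Measure ((ℝ × ℝ) × (ℝ × ℝ))}
    (hπ : π ∈ transportPlans μ ν) : π.map Prod.swap ∈ transportPlans ν μ := by
  refine ⟨?_, fun A hA hAs => ?_, fun A hA hAs => ?_⟩
  · rw [Measure.map_apply measurable_swap
      (measurableSet_closedHalfPlane.prod measurableSet_closedHalfPlane).compl, Set.preimage_compl,
      Set.preimage_swap_prod]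
    exact hπ.1
  · rw [Measure.map_apply measurable_swap (measurable_fst hA)]
    exact hπ.2.2 A hA hAs
  · rw [Measure.map_apply measurable_swap (measurable_snd hA)]
    exact hπ.2.1 A hA hAs

lemma cost_comm_le (r : ℝ) (μ ν : Measure (ℝ × ℝ)) : cost r ν μ ≤ cost r μ ν := by
  refine le_iInf₂ fun π hπ => (iInf₂_le _ (swap_mem_transportPlans hπ)).trans ?_
  rw [lintegral_map (by fun_prop) measurable_swap]
  simp only [Prod.fst_swap, Prod.snd_swap, edist_comm, le_refl]

lemma cost_comm (r : ℝ) (μ ν : Measure (ℝ × ℝ)) : cost r ν μ = cost r μ ν :=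
  le_antisymm (cost_comm_le r μ ν) (cost_comm_le r ν μ)

/-- For a 1-Lipschitz `u`, mass leaving `{s ≤ u}` without ending in `{s - δ ≤ u}` travels at least
`δ`. -/
lemma measure_superlevel_le {r : ℝ} (hr : 0 < r) {u : ℝ × ℝ → ℝ} (hu : Continuous u)
    (hlip : ∀ z w, u z - u w ≤ dist z w) {s δ : ℝ} (hδ : 0 < δ)
    (hs : {z | s - δ ≤ u z} ⊆ halfPlane) (μ ν : Measure (ℝ × ℝ)) :
    μ {z | s ≤ u z} ≤ ν {z | s - δ ≤ u z} + cost r μ ν / ENNReal.ofReal (δ ^ r) := by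
  have hδr : ENNReal.ofReal (δ ^ r) ≠ 0 := by simp; positivity
  rw [← tsub_le_iff_left, ENNReal.le_div_iff_mul_le (Or.inl hδr) (Or.inl ENNReal.ofReal_ne_top)]
  refine le_iInf₂ fun π hπ => ?_
  rw [← ENNReal.le_div_iff_mul_le (Or.inl hδr) (Or.inl ENNReal.ofReal_ne_top), tsub_le_iff_left,
    ← hπ.2.1 _ (isClosed_le continuous_const hu).measurableSet
      (fun z hz => hs (show s - δ ≤ u z from (by linarith : s - δ ≤ s).trans hz)),
    ← hπ.2.2 _ (isClosed_le continuous_const hu).measurableSet hs]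
  have hm : Measurable fun z : (ℝ × ℝ) × (ℝ × ℝ) => edist z.1 z.2 ^ r := by fun_prop
  refine le_trans (measure_mono ?_) ((measure_union_le _ _).trans
    (add_le_add_right (meas_ge_le_lintegral_div hm.aemeasurable hδr ENNReal.ofReal_ne_top) _))
  intro z hz
  have hz' : s ≤ u z.1 := hz
  by_cases h : s - δ ≤ u z.2
  · exact Or.inl h
  · right
    have := hlip z.1 z.2
    simp only [Set.mem_ofPred_eq, edist_rpow hr.le]
    gcongr
    linarith

/-- Convergence of the masses of `{0 ≤ u}` when the level set `{u = 0}` is null; tails and quadrants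
are both of this form. -/
lemma tendsto_measure_superlevel {r : ℝ} (hr : 0 < r) {u : ℝ × ℝ → ℝ} (hu : Continuous u)
    (hlip : ∀ z w, u z - u w ≤ dist z w) {μn : ℕ → Measure (ℝ × ℝ)} {μ : Measure (ℝ × ℝ)}
    {s : ℝ} (hs : s < 0)
    (hsub : {z | s ≤ u z} ⊆ halfPlane) (hfin : μ {z | s ≤ u z} ≠ ⊤) (hnull : μ {z | u z = 0} = 0)
    (hc : Tendsto (fun n => cost r (μn n) μ) atTop (𝓝 0)) :
    Tendsto (fun n => μn n {z | 0 ≤ u z}) atTop (𝓝 (μ {z | 0 ≤ u z})) := by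
  have hms : ∀ t, MeasurableSet {z | t ≤ u z} := fun t =>
    (isClosed_le continuous_const hu).measurableSet
  obtain ⟨d, hd_anti, hd_mem, hdlim⟩ := exists_seq_strictAnti_tendsto' (neg_pos.2 hs)
  have hd : ∀ k, 0 < d k := fun k => (hd_mem k).1
  have hd1 : ∀ k, d k ≤ -s := fun k => (hd_mem k).2.le
  have hanti : Antitone d := hd_anti.antitone
  have hsup : μ {z | 0 ≤ u z} = ⨆ k : ℕ, μ {z | d k ≤ u z} := by
    have hmono : Monotone fun k => {z | d k ≤ u z} := fun i j hij z hz =>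
      (hanti hij).trans (show d i ≤ u z from hz)
    rw [← hmono.measure_iUnion]
    have e : (⋃ k : ℕ, {z | d k ≤ u z}) = {z | 0 < u z} := by
      ext z
      simp only [Set.mem_iUnion, Set.mem_ofPred_eq]
      exact ⟨fun ⟨k, hk⟩ => (hd k).trans_le hk, fun h =>
        ((tendsto_order.1 hdlim).2 _ h).exists.imp fun _ h => h.le⟩
    rw [e]
    refine le_antisymm ?_ (measure_mono fun z (hz : 0 < u z) => hz.le)
    refine (measure_mono (t := {z | 0 < u z} ∪ {z | u z = 0}) fun z (hz : 0 ≤ u z) => ?_).trans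
      ((measure_union_le _ _).trans (by rw [hnull, add_zero]))
    exact hz.lt_or_eq.imp id Eq.symm
  have hinf : μ {z | 0 ≤ u z} = ⨅ k : ℕ, μ {z | 0 - d k ≤ u z} := by
    have hanti' : Antitone fun k => {z | 0 - d k ≤ u z} := fun i j hij z hz =>
      (sub_le_sub_left (hanti hij) 0).trans (show 0 - d j ≤ u z from hz)
    rw [← hanti'.measure_iInter (fun k => (hms _).nullMeasurableSet)
      ⟨0, measure_ne_top_of_subset (fun z hz => ?_) hfin⟩]
    swap
    · exact (by linarith [hd1 0] : s ≤ 0 - d 0).trans (show 0 - d 0 ≤ u z from hz)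
    congr 1
    ext z
    simp only [Set.mem_iInter, Set.mem_ofPred_eq]
    refine ⟨fun h k => by linarith [hd k], fun h => ?_⟩
    have := hdlim.const_sub 0
    rw [sub_zero] at this
    exact le_of_tendsto' this h
  have hcδ : ∀ k : ℕ, Tendsto (fun n => cost r (μn n) μ /
      ENNReal.ofReal ((d k) ^ r)) atTop (𝓝 0) := fun k => by
    have hk : ENNReal.ofReal ((d k) ^ r) ≠ 0 := by
      simpa using Real.rpow_pos_of_pos (hd k) r
    simpa using ENNReal.Tendsto.div_const hc (Or.inr hk)
  refine tendsto_order.2 ⟨fun a ha => ?_, fun a ha => ?_⟩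
  · rw [hsup] at ha
    obtain ⟨k, hk⟩ := lt_iSup_iff.1 ha
    filter_upwards [(tendsto_order.1 (hcδ k)).2 _ (tsub_pos_of_lt hk)] with n hn
    have h1 := measure_superlevel_le hr hu hlip (s := d k) (hd k) (by
      rw [sub_self]; exact fun z hz => hsub (hs.le.trans hz)) μ (μn n)
    rw [cost_comm, sub_self] at h1
    have h2 : a + cost r (μn n) μ / ENNReal.ofReal ((d k) ^ r) <
        μ {z | d k ≤ u z} := by
      have := ENNReal.add_lt_add_left (hk.ne_top) hn
      rwa [add_tsub_cancel_of_le hk.le] at this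
    exact lt_of_add_lt_add_right (h2.trans_le h1)
  · rw [hinf] at ha
    obtain ⟨k, hk⟩ := iInf_lt_iff.1 ha
    filter_upwards [(tendsto_order.1 (hcδ k)).2 _ (tsub_pos_of_lt hk)] with n hn
    refine (measure_superlevel_le hr hu hlip (s := 0) (hd k) (fun z hz => hsub ?_) (μn n) μ).trans_lt ?_
    · have : 0 - d k ≤ u z := hz
      exact (by linarith [hd1 k] : s ≤ _).trans this
    · have := ENNReal.add_lt_add_left (hk.ne_top) hn
      rwa [add_tsub_cancel_of_le hk.le] at this

lemma TailBound.sigmaFinite {p q C : ℝ} {μ : Measure (ℝ × ℝ)} (h : TailBound p q C μ)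
    (h0 : μ halfPlaneᶜ = 0) : SigmaFinite μ := by
  refine ⟨⟨⟨fun n => tail (1 / ((n : ℝ) + 1)) ∪ halfPlaneᶜ, fun _ => trivial, fun n => ?_, ?_⟩⟩⟩
  · refine (measure_union_le _ _).trans_lt ?_
    rw [h0, add_zero]
    exact h.lt_top (by positivity)
  · refine Set.eq_univ_of_forall fun z => Set.mem_iUnion.2 ?_
    by_cases hz : z ∈ halfPlane
    · obtain ⟨n, hn⟩ := exists_nat_one_div_lt (gap_pos_iff.2 hz)
      refine ⟨n, Or.inl ?_⟩
      rw [tail_eq (by positivity)]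
      exact hn.le
    · exact ⟨0, Or.inr hz⟩

/-- The exceptional parameters are those for which `μ` charges one of the level sets of `gap`, `fst`
or `snd`; each of these families contains only countably many charged sets. -/
lemma ae_tendsto_of_tendsto_cost {p q C r : ℝ} (hr : 0 < r)
    {μn : ℕ → Measure (ℝ × ℝ)} {μ : Measure (ℝ × ℝ)} (hμ : TailBound p q C μ)
    (h0 : μ halfPlaneᶜ = 0) (hc : Tendsto (fun n => cost r (μn n) μ) atTop (𝓝 0)) :
    ∀ᵐ w : ℝ × ℝ, 0 < w.2 →
      Tendsto (fun n => μn n (tail w.2)) atTop (𝓝 (μ (tail w.2))) ∧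
      Tendsto (fun n => μn n (quadrant w.1 w.2)) atTop (𝓝 (μ (quadrant w.1 w.2))) := by
  have := hμ.sigmaFinite h0
  have c1 := Measure.countable_meas_level_set_pos (μ := μ) continuous_gap.measurable
  have c2 := Measure.countable_meas_level_set_pos (μ := μ) (measurable_fst (α := ℝ) (β := ℝ))
  have c3 := Measure.countable_meas_level_set_pos (μ := μ) (measurable_snd (α := ℝ) (β := ℝ))
  have a1 : ∀ᵐ w : ℝ × ℝ, w.2 ∉ {t : ℝ | 0 < μ {z | gap z = t}} :=
    Measure.quasiMeasurePreserving_snd.ae (c1.ae_notMem _)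
  have a2 : ∀ᵐ w : ℝ × ℝ, w.1 ∉ {t : ℝ | 0 < μ {z | z.1 = t}} :=
    Measure.quasiMeasurePreserving_fst.ae (c2.ae_notMem _)
  have a3 : ∀ᵐ w : ℝ × ℝ, w.1 + w.2 ∉ {t : ℝ | 0 < μ {z | z.2 = t}} :=
    (Measure.quasiMeasurePreserving_snd.comp (measurePreserving_prod_add (volume : Measure ℝ)
      (volume : Measure ℝ)).quasiMeasurePreserving).ae (c3.ae_notMem _)
  filter_upwards [a1, a2, a3] with w h1 h2 h3 hw
  simp only [not_lt, nonpos_iff_eq_zero] at h1 h2 h3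
  constructor
  · have e : tail w.2 = {z | 0 ≤ gap z - w.2} := by
      rw [tail_eq hw]; simp only [sub_nonneg]
    have e2 : {z | -(w.2 / 2) ≤ gap z - w.2} = tail (w.2 / 2) := by
      rw [tail_eq (by positivity)]; ext z
      simp only [Set.mem_ofPred_eq]
      constructor <;> intro h <;> linarith
    rw [e]
    refine tendsto_measure_superlevel hr (by fun_prop) (fun z z' => ?_) (s := -(w.2 / 2))
      (by linarith) ?_ ?_ ?_ hc
    · linarith [(le_abs_self _).trans (abs_gap_sub_le z z')]
    · rw [e2]; exact tail_subset_halfPlane _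
    · rw [e2]; exact (hμ.lt_top (by positivity)).ne
    · simpa only [sub_eq_zero] using h1
  · have e : quadrant w.1 w.2 = {z | 0 ≤ min (w.1 - z.1) (z.2 - w.1 - w.2)} := by
      ext z
      simp only [quadrant, Set.mem_prod, Set.mem_Iic, Set.mem_Ici, Set.mem_ofPred_eq, le_min_iff]
      constructor <;> rintro ⟨h, h'⟩ <;> constructor <;> linarith
    have e2 : {z : ℝ × ℝ | -(w.2 / 4) ≤ min (w.1 - z.1) (z.2 - w.1 - w.2)} ⊆ tail (w.2 / 4) := by
      rw [tail_eq (by positivity)]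
      intro z hz
      simp only [Set.mem_ofPred_eq, le_min_iff] at hz
      refine le_max_of_le_left (?_ : w.2 / 4 ≤ (z.2 - z.1) / 2)
      linarith
    rw [e]
    refine tendsto_measure_superlevel hr (by fun_prop) (fun z z' => ?_) (s := -(w.2 / 4))
      (by linarith) ?_ ?_ ?_ hc
    · rw [Prod.dist_eq, Real.dist_eq, Real.dist_eq]
      refine (le_abs_self _).trans ((abs_min_sub_min_le_max _ _ _ _).trans (max_le_max ?_ ?_))
      · rw [abs_sub_comm z.1]; apply le_of_eq; congr 1; ring
      · apply le_of_eq; congr 1; ring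
    · exact e2.trans (tail_subset_halfPlane _)
    · exact ((measure_mono e2).trans_lt (hμ.lt_top (by positivity))).ne
    · refine measure_mono_null (t := {z | z.1 = w.1} ∪ {z | z.2 = w.1 + w.2}) (fun z hz => ?_)
        (measure_union_null h2 h3)
      simp only [Set.mem_ofPred_eq] at hz
      rcases min_choice (w.1 - z.1) (z.2 - w.1 - w.2) with h | h <;> rw [h] at hz
      · exact Or.inl (show z.1 = w.1 by linarith)
      · exact Or.inr (show z.2 = w.1 + w.2 by linarith)

/-! ### Uniform convergence of Mellin transforms -/

/-- The common features of `ε ↦ μ (tail ε)` and `ε ↦ μ (quadrant x ε)` on `]0, ∞[`: a nonnegative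
antitone function dominated by `C * min (t ^ (-p)) (t ^ (-q))`. -/
structure TailLike (p q C : ℝ) (F : ℝ → ℝ) : Prop where
  anti : AntitoneOn F (Set.Ioi 0)
  nonneg : ∀ t, 0 < t → 0 ≤ F t
  le : ∀ t, 0 < t → F t ≤ C * min (t ^ (-p)) (t ^ (-q))

lemma TailBound.tailLike_tail {p q C : ℝ} {μ : Measure (ℝ × ℝ)} (h : TailBound p q C μ)
    (hC : 0 ≤ C) : TailLike p q C fun ε => μ.real (tail ε) where
  anti s hs t _ hst := measureReal_mono (tail_anti hst) (h.lt_top hs).ne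
  nonneg _ _ := measureReal_nonneg
  le t ht := ENNReal.toReal_le_of_le_ofReal (by positivity) (h t ht)

lemma TailBound.quadrant_lt_top {p q C : ℝ} {μ : Measure (ℝ × ℝ)} (h : TailBound p q C μ) (x : ℝ)
    {ε : ℝ} (hε : 0 < ε) : μ (quadrant x ε) < ⊤ :=
  (measure_mono (quadrant_subset_tail hε x)).trans_lt (h.lt_top (half_pos hε))

lemma TailBound.tailLike_quadrant {p q C : ℝ} {μ : Measure (ℝ × ℝ)} (h : TailBound p q C μ)
    (hpq : p < q) (hC : 0 ≤ C) (x : ℝ) :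
    TailLike p q (C * 2 ^ q) fun ε => μ.real (quadrant x ε) where
  anti s hs t _ hst := measureReal_mono
    (Set.prod_mono subset_rfl (Set.Ici_subset_Ici.2 (by linarith))) (h.quadrant_lt_top x hs).ne
  nonneg _ _ := measureReal_nonneg
  le t ht := by
    have h1 := (h.tailLike_tail hC).le (t / 2) (half_pos ht)
    refine (measureReal_mono (quadrant_subset_tail ht x) (h.lt_top (half_pos ht)).ne).trans
      (h1.trans ?_)
    rw [mul_assoc, mul_min_of_nonneg (t ^ (-p)) (t ^ (-q)) (by positivity : (0 : ℝ) ≤ 2 ^ q)]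
    have e : ∀ a : ℝ, (t / 2) ^ (-a) = 2 ^ a * t ^ (-a) := fun a => by
      rw [Real.div_rpow ht.le (by norm_num), Real.rpow_neg (by norm_num : (0 : ℝ) ≤ 2), div_inv_eq_mul,
        mul_comm]
    rw [e, e]
    gcongr
    norm_num

section Mellin

variable {p q C : ℝ} {F : ℝ → ℝ}

lemma TailLike.aemeasurable (hF : TailLike p q C F) :
    AEMeasurable F (volume.restrict (Set.Ioi 0)) :=
  aemeasurable_restrict_of_antitoneOn measurableSet_Ioi hF.anti

lemma TailLike.norm_le (hF : TailLike p q C F) {t : ℝ} (ht : 0 < t) :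
    ‖F t‖ ≤ C * min (t ^ (-p)) (t ^ (-q)) := by
  rw [Real.norm_of_nonneg (hF.nonneg t ht)]; exact hF.le t ht

lemma norm_cpow_smul {t : ℝ} (ht : 0 < t) (s : ℂ) (y : ℝ) :
    ‖(t : ℂ) ^ (s - 1) • (y : ℂ)‖ = t ^ (s.re - 1) * ‖y‖ := by
  rw [norm_smul, Complex.norm_cpow_eq_rpow_re_of_pos ht, Complex.norm_real]
  simp

lemma TailLike.mellinConvergent (hF : TailLike p q C F) {s : ℂ} (hs : s ∈ strip p q) :
    MellinConvergent (fun t => (F t : ℂ)) s := by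
  refine ((integrableOn_min_rpow hs.1 hs.2).const_mul C).mono' ?_ ?_
  · refine AEStronglyMeasurable.smul (f := fun t : ℝ => (t : ℂ) ^ (s - 1)) ?_ ?_
    · refine ContinuousOn.aestronglyMeasurable (fun t ht => ?_) measurableSet_Ioi
      exact ((Complex.continuousAt_ofReal_cpow_const _ _ (Or.inr (ne_of_gt ht)))).continuousWithinAt
    · exact (Complex.measurable_ofReal.comp_aemeasurable hF.aemeasurable).aestronglyMeasurable
  · filter_upwards [ae_restrict_mem measurableSet_Ioi] with t ht
    have h0 : (0 : ℝ) < t := ht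
    rw [norm_cpow_smul h0]
    have := hF.norm_le h0
    calc _ ≤ t ^ (s.re - 1) * (C * min (t ^ (-p)) (t ^ (-q))) := by gcongr
      _ = _ := by ring

/-- On a compact subset of the strip, `Re s` stays in some `[a, b]` with `p < a` and `b < q`, so the
difference of the Mellin transforms is dominated, uniformly in `s`, by an integral with weight
`t ^ (a - 1) + t ^ (b - 1)`, to which dominated convergence applies. -/
lemma TailLike.tendstoUniformlyOn_mellin {Fn : ℕ → ℝ → ℝ} (hFn : ∀ n, TailLike p q C (Fn n))
    (hF : TailLike p q C F)
    (hlim : ∀ᵐ t ∂(volume.restrict (Set.Ioi 0)), Tendsto (fun n => Fn n t) atTop (𝓝 (F t)))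
    {K : Set ℂ} (hK : IsCompact K) (hKs : K ⊆ strip p q) :
    TendstoUniformlyOn (fun n s => s * mellin (fun t => (Fn n t : ℂ)) s)
      (fun s => s * mellin (fun t => (F t : ℂ)) s) atTop K := by
  obtain ⟨a, hpa, ha⟩ := hK.exists_forall_le' (f := Complex.re) Complex.continuous_re.continuousOn
    (a := p) (fun z hz => (hKs hz).1)
  obtain ⟨b, hqb, hb⟩ : ∃ b, b < q ∧ ∀ z ∈ K, z.re ≤ b := by
    obtain ⟨b, hb, hbK⟩ := hK.exists_forall_le' (f := fun z => -z.re)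
      Complex.continuous_re.neg.continuousOn (a := -q) (fun z hz => neg_lt_neg (hKs hz).2)
    exact ⟨-b, by linarith, fun z hz => by linarith [hbK z hz]⟩
  rcases K.eq_empty_or_nonempty with rfl | ⟨s0, hs0⟩
  · exact tendstoUniformlyOn_empty
  have hab : a ≤ b := (ha s0 hs0).trans (hb s0 hs0)
  obtain ⟨R, hR0, hR⟩ := hK.isBounded.exists_pos_norm_le
  set w : ℝ → ℝ := fun t => t ^ (a - 1) + t ^ (b - 1) with hw
  have hwm : Measurable w := by fun_prop
  have hmeas : ∀ n, AEMeasurable (fun t => w t * |Fn n t - F t|) (volume.restrict (Set.Ioi 0)) :=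
    fun n => hwm.aemeasurable.mul
      (measurable_norm.comp_aemeasurable ((hFn n).aemeasurable.sub hF.aemeasurable))
  have hdom : Integrable (fun t : ℝ => 2 * C * (t ^ (a - 1) * min (t ^ (-p)) (t ^ (-q)) +
      t ^ (b - 1) * min (t ^ (-p)) (t ^ (-q)))) (volume.restrict (Set.Ioi 0)) :=
    ((integrableOn_min_rpow hpa (hab.trans_lt hqb)).add
      (integrableOn_min_rpow (hpa.trans_le hab) hqb)).const_mul _
  have hle : ∀ n, ∀ᵐ t ∂(volume.restrict (Set.Ioi 0)), ‖w t * |Fn n t - F t|‖ ≤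
      2 * C * (t ^ (a - 1) * min (t ^ (-p)) (t ^ (-q)) +
        t ^ (b - 1) * min (t ^ (-p)) (t ^ (-q))) := fun n => by
    filter_upwards [ae_restrict_mem measurableSet_Ioi] with t ht
    have h0 : (0 : ℝ) < t := ht
    have h1 := (hFn n).norm_le h0
    have h2 := hF.norm_le h0
    have hw0 : 0 ≤ w t := by simp only [hw]; positivity
    rw [Real.norm_of_nonneg (by positivity)]
    calc w t * |Fn n t - F t| ≤ w t * (2 * (C * min (t ^ (-p)) (t ^ (-q)))) := by
          gcongr
          refine (norm_sub_le (Fn n t) (F t)).trans ?_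
          linarith
      _ = _ := by simp only [hw]; ring
  have hI : Tendsto (fun n => ∫ t in Set.Ioi 0, w t * |Fn n t - F t|) atTop (𝓝 0) := by
    have := tendsto_integral_of_dominated_convergence (μ := volume.restrict (Set.Ioi 0))
      (F := fun n t => w t * |Fn n t - F t|) (f := fun _ => (0 : ℝ)) _
      (fun n => (hmeas n).aestronglyMeasurable) hdom hle (by
        filter_upwards [hlim] with t ht
        simpa using ((ht.sub_const (F t)).abs).const_mul (w t))
    simpa using this
  refine Metric.tendstoUniformlyOn_iff.2 fun ε hε => ?_
  filter_upwards [(tendsto_order.1 hI).2 (ε / R) (by positivity)] with n hn s hs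
  have h1 : ‖mellin (fun t => (F t : ℂ)) s - mellin (fun t => (Fn n t : ℂ)) s‖ ≤
      ∫ t in Set.Ioi 0, w t * |Fn n t - F t| := by
    rw [mellin, mellin, ← integral_sub (hF.mellinConvergent (hKs hs))
      ((hFn n).mellinConvergent (hKs hs))]
    refine norm_integral_le_of_norm_le (hdom.mono' (hmeas n).aestronglyMeasurable (hle n)) ?_
    filter_upwards [ae_restrict_mem measurableSet_Ioi] with t ht
    have h0 : (0 : ℝ) < t := ht
    rw [← smul_sub, ← Complex.ofReal_sub, norm_cpow_smul h0, ← Real.norm_eq_abs, norm_sub_rev]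
    gcongr
    rcases le_total t 1 with h | h
    · have := Real.rpow_le_rpow_of_exponent_ge h0 h (by linarith [ha s hs] : a - 1 ≤ s.re - 1)
      have : 0 ≤ t ^ (b - 1) := by positivity
      simp only [hw]; linarith
    · have := Real.rpow_le_rpow_of_exponent_le h (by linarith [hb s hs] : s.re - 1 ≤ b - 1)
      have : 0 ≤ t ^ (a - 1) := by positivity
      simp only [hw]; linarith
  rw [dist_eq_norm, ← mul_sub, norm_mul]
  calc _ ≤ R * ∫ t in Set.Ioi 0, w t * |Fn n t - F t| :=
        mul_le_mul (hR s hs) h1 (norm_nonneg _) hR0.le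
    _ < R * (ε / R) := by gcongr
    _ = ε := by field_simp

end Mellin

lemma tendstoUniformlyOn_zeta_of_ae {p q C : ℝ} (hpq : p < q) (hC : 0 ≤ C)
    {μn : ℕ → Measure (ℝ × ℝ)} {μ : Measure (ℝ × ℝ)} (hμn : ∀ n, TailBound p q C (μn n))
    (hμ : TailBound p q C μ)
    (h : ∀ᵐ w : ℝ × ℝ, 0 < w.2 →
      Tendsto (fun n => μn n (tail w.2)) atTop (𝓝 (μ (tail w.2))) ∧
      Tendsto (fun n => μn n (quadrant w.1 w.2)) atTop (𝓝 (μ (quadrant w.1 w.2)))) :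
    ∀ᵐ x : ℝ, ∀ K : Set ℂ, IsCompact K → K ⊆ strip p q →
      TendstoUniformlyOn (fun n => localZeta (μn n) x) (localZeta μ x) atTop K ∧
      TendstoUniformlyOn (fun n => zeta (μn n)) (zeta μ) atTop K := by
  have h' := Measure.ae_ae_of_ae_prod h
  filter_upwards [h'] with x hx K hK hKs
  constructor
  · refine TailLike.tendstoUniformlyOn_mellin (fun n => (hμn n).tailLike_quadrant hpq hC x)
      (hμ.tailLike_quadrant hpq hC x) ?_ hK hKs
    filter_upwards [ae_restrict_mem measurableSet_Ioi, ae_restrict_of_ae hx] with t ht hxt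
    exact (ENNReal.tendsto_toReal (hμ.quadrant_lt_top x ht).ne).comp (hxt ht).2
  · refine TailLike.tendstoUniformlyOn_mellin (fun n => (hμn n).tailLike_tail hC)
      (hμ.tailLike_tail hC) ?_ hK hKs
    filter_upwards [ae_restrict_mem measurableSet_Ioi, ae_restrict_of_ae hx] with t ht hxt
    exact (ENNReal.tendsto_toReal (hμ.lt_top ht).ne).comp (hxt ht).1

/-! ### Recovering monotone functions from their Mellin transforms -/

section Fourier

open FourierTransform SchwartzMap

section MellinInj

variable {p q C : ℝ} {F : ℝ → ℝ}

lemma TailLike.monotone_comp (hF : TailLike p q C F) : Monotone fun u => F (Real.exp (-u)) :=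
  fun u v huv => hF.anti (Real.exp_pos _) (Real.exp_pos _) (Real.exp_le_exp.2 (by linarith))

lemma integrable_exp_bound {σ : ℝ} (hpσ : p < σ) (hσq : σ < q) :
    Integrable fun u : ℝ =>
      Real.exp (-σ * u) * min (Real.exp (-u) ^ (-p)) (Real.exp (-u) ^ (-q)) := by
  have hm : Measurable fun u : ℝ =>
      Real.exp (-σ * u) * min (Real.exp (-u) ^ (-p)) (Real.exp (-u) ^ (-q)) := by fun_prop
  rw [← integrableOn_univ, ← Set.Iic_union_Ioi (a := (0 : ℝ)), integrableOn_union]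
  constructor
  · refine (integrableOn_exp_mul_Iic (a := q - σ) (by linarith) 0).mono'
      hm.aestronglyMeasurable.restrict (ae_of_all _ fun u => ?_)
    rw [Real.norm_of_nonneg (by positivity)]
    refine (mul_le_mul_of_nonneg_left (min_le_right _ _) (by positivity)).trans (le_of_eq ?_)
    rw [← Real.exp_mul, ← Real.exp_add]; congr 1; ring
  · refine (integrableOn_exp_mul_Ioi (a := p - σ) (by linarith) 0).mono'
      hm.aestronglyMeasurable.restrict (ae_of_all _ fun u => ?_)
    rw [Real.norm_of_nonneg (by positivity)]
    refine (mul_le_mul_of_nonneg_left (min_le_left _ _) (by positivity)).trans (le_of_eq ?_)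
    rw [← Real.exp_mul, ← Real.exp_add]; congr 1; ring

/-- The function on the line whose Fourier transform is the restriction of the Mellin transform of
`F` to the vertical line `Re s = σ`; the substitution is `t = exp (-u)`. -/
noncomputable def logTail (σ : ℝ) (F : ℝ → ℝ) (u : ℝ) : ℂ :=
  Real.exp (-σ * u) • (F (Real.exp (-u)) : ℂ)

lemma norm_logTail (σ : ℝ) (F : ℝ → ℝ) (u : ℝ) :
    ‖logTail σ F u‖ = Real.exp (-σ * u) * ‖F (Real.exp (-u))‖ := by
  rw [logTail, norm_smul, Complex.norm_real, Real.norm_of_nonneg (Real.exp_nonneg _)]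

lemma TailLike.norm_logTail_le (hF : TailLike p q C F) (σ u : ℝ) :
    ‖logTail σ F u‖ ≤
      C * (Real.exp (-σ * u) * min (Real.exp (-u) ^ (-p)) (Real.exp (-u) ^ (-q))) := by
  rw [norm_logTail, mul_left_comm]
  exact mul_le_mul_of_nonneg_left (hF.norm_le (Real.exp_pos _)) (Real.exp_nonneg _)

lemma TailLike.integrable_logTail (hF : TailLike p q C F) {σ : ℝ} (hpσ : p < σ) (hσq : σ < q) :
    Integrable (logTail σ F) := by
  refine ((integrable_exp_bound hpσ hσq).const_mul C).mono' ?_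
    (ae_of_all _ fun u => hF.norm_logTail_le σ u)
  have := Complex.measurable_ofReal.comp hF.monotone_comp.measurable
  exact (Measurable.smul (f := fun u : ℝ => Real.exp (-σ * u)) (by fun_prop)
    this).aestronglyMeasurable

lemma TailLike.norm_fourier_logTail_le (hF : TailLike p q C F) {σ : ℝ} (hpσ : p < σ) (hσq : σ < q)
    (y : ℝ) : ‖𝓕 (logTail σ F) y‖ ≤
      ∫ u, C * (Real.exp (-σ * u) * min (Real.exp (-u) ^ (-p)) (Real.exp (-u) ^ (-q))) := by
  refine (VectorFourier.norm_fourierIntegral_le_integral_norm _ _ _ _ _).trans ?_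
  exact integral_mono (hF.integrable_logTail hpσ hσq).norm
    ((integrable_exp_bound hpσ hσq).const_mul C) fun u => hF.norm_logTail_le σ u

/-- Parseval duality: a Schwartz function is the Fourier transform of its inverse Fourier transform,
and the Fourier transform is self-adjoint for the bilinear pairing. -/
lemma TailLike.integral_fourier_mul (hF : TailLike p q C F) {σ : ℝ} (hpσ : p < σ) (hσq : σ < q)
    (φ : 𝓢(ℝ, ℂ)) :
    ∫ y, 𝓕 (logTail σ F) y * (𝓕⁻ φ) y = ∫ u, logTail σ F u * φ u := by
  have := VectorFourier.integral_fourierIntegral_smul_eq_flip (L := innerₗ ℝ)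
      Real.continuous_fourierChar continuous_inner (hF.integrable_logTail hpσ hσq)
      (SchwartzMap.integrable (μ := volume) (𝓕⁻ φ : 𝓢(ℝ, ℂ)))
  have h2 : 𝓕 ((𝓕⁻ φ : 𝓢(ℝ, ℂ)) : ℝ → ℂ) = φ := by
    rw [← SchwartzMap.fourier_coe, FourierTransform.fourier_fourierInv_eq]
  simp only [flip_innerₗ, smul_eq_mul] at this
  rw [← h2]
  exact this

/-- Pointwise convergence of Mellin transforms on one vertical line gives convergence in the sense
of tempered distributions, since the Fourier transforms are uniformly bounded. -/
lemma TailLike.tendsto_integral_logTail {Fn : ℕ → ℝ → ℝ} (hFn : ∀ n, TailLike p q C (Fn n))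
    (hF : TailLike p q C F) {σ : ℝ} (hpσ : p < σ) (hσq : σ < q)
    (h : ∀ s : ℂ, s.re = σ → Tendsto (fun n => mellin (fun t => (Fn n t : ℂ)) s) atTop
      (𝓝 (mellin (fun t => (F t : ℂ)) s))) (φ : 𝓢(ℝ, ℂ)) :
    Tendsto (fun n => ∫ u, logTail σ (Fn n) u * φ u) atTop (𝓝 (∫ u, logTail σ F u * φ u)) := by
  simp_rw [← fun n => (hFn n).integral_fourier_mul hpσ hσq φ, ← hF.integral_fourier_mul hpσ hσq φ]
  have hmel : ∀ (G : ℝ → ℝ) (y : ℝ), mellin (fun t => (G t : ℂ)) ⟨σ, 2 * Real.pi * y⟩ =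
      𝓕 (logTail σ G) y := fun G y => by
    rw [mellin_eq_fourier]
    have : 2 * Real.pi * y / (2 * Real.pi) = y := by field_simp
    simp only [this]; rfl
  refine tendsto_integral_of_dominated_convergence
    (fun y => (∫ u, C * (Real.exp (-σ * u) * min (Real.exp (-u) ^ (-p)) (Real.exp (-u) ^ (-q)))) *
      ‖(𝓕⁻ φ : 𝓢(ℝ, ℂ)) y‖) (fun n => ?_) ((𝓕⁻ φ : 𝓢(ℝ, ℂ)).integrable.norm.const_mul _)
    (fun n => ae_of_all _ fun y => ?_) (ae_of_all _ fun y => ?_)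
  · refine Continuous.aestronglyMeasurable (Continuous.mul ?_ (𝓕⁻ φ : 𝓢(ℝ, ℂ)).continuous)
    exact VectorFourier.fourierIntegral_continuous Real.continuous_fourierChar continuous_inner
      ((hFn n).integrable_logTail hpσ hσq)
  · rw [norm_mul]
    gcongr
    exact (hFn n).norm_fourier_logTail_le hpσ hσq y
  · refine Tendsto.mul_const _ ?_
    have := h ⟨σ, 2 * Real.pi * y⟩ rfl
    simpa only [hmel] using this

lemma TailLike.tendsto_integral_smooth {Fn : ℕ → ℝ → ℝ} (hFn : ∀ n, TailLike p q C (Fn n))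
    (hF : TailLike p q C F) {σ : ℝ} (hpσ : p < σ) (hσq : σ < q)
    (h : ∀ s : ℂ, s.re = σ → Tendsto (fun n => mellin (fun t => (Fn n t : ℂ)) s) atTop
      (𝓝 (mellin (fun t => (F t : ℂ)) s))) {ψ : ℝ → ℝ} (hψ : ContDiff ℝ (⊤ : ℕ∞) ψ)
    (hψc : HasCompactSupport ψ) :
    Tendsto (fun n => ∫ u, Fn n (Real.exp (-u)) * ψ u) atTop
      (𝓝 (∫ u, F (Real.exp (-u)) * ψ u)) := by
  have hc : HasCompactSupport fun u : ℝ => ((Real.exp (σ * u) * ψ u : ℝ) : ℂ) :=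
    (hψc.mul_left (f := fun u => Real.exp (σ * u))).comp_left (g := ((↑) : ℝ → ℂ)) rfl
  have hs : ContDiff ℝ (⊤ : ℕ∞) fun u : ℝ => ((Real.exp (σ * u) * ψ u : ℝ) : ℂ) :=
    Complex.ofRealCLM.contDiff.comp
      ((Real.contDiff_exp.comp (contDiff_const.mul contDiff_id)).mul hψ)
  have key := hF.tendsto_integral_logTail hFn hpσ hσq h (hc.toSchwartzMap hs)
  have e : ∀ G : ℝ → ℝ, ∫ u, logTail σ G u * (hc.toSchwartzMap hs) u =
      ((∫ u, G (Real.exp (-u)) * ψ u : ℝ) : ℂ) := fun G => by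
    rw [← integral_complex_ofReal]
    refine integral_congr_ae (ae_of_all _ fun u => ?_)
    have : (hc.toSchwartzMap hs) u = ((Real.exp (σ * u) * ψ u : ℝ) : ℂ) := rfl
    simp only [this, logTail, Complex.real_smul]
    rw [← Complex.ofReal_mul, ← Complex.ofReal_mul]
    congr 1
    have h1 : Real.exp (-σ * u) * Real.exp (σ * u) = 1 := by
      rw [← Real.exp_add]; simp
    linear_combination G (Real.exp (-u)) * ψ u * h1
  simp only [e] at key
  have := (Complex.continuous_re.tendsto _).comp key
  simpa [Function.comp_def] using this

/-- Averaging a monotone function against a normalized bump gives a value between those at the end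
points of the support. -/
lemma _root_.Monotone.integral_mul_normed_bump_mem {G : ℝ → ℝ} (hG : Monotone G) {c : ℝ}
    (φ : ContDiffBump c) :
    (∫ u, G u * φ.normed volume u) ∈ Set.Icc (G (c - φ.rOut)) (G (c + φ.rOut)) := by
  have hI : Integrable fun u => G u * φ.normed volume u :=
    hG.locallyIntegrable.integrable_smul_right_of_hasCompactSupport φ.continuous_normed
      φ.hasCompactSupport_normed
  have hconst : ∀ a : ℝ, ∫ u, a * φ.normed volume u = a := fun a => by
    rw [integral_const_mul, φ.integral_normed, mul_one]
  have hsupp : ∀ u, φ.normed volume u ≠ 0 → u ∈ Metric.ball c φ.rOut := fun u hu => by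
    rw [← φ.support_normed_eq (μ := volume)]; exact hu
  constructor
  · rw [← hconst (G (c - φ.rOut))]
    refine integral_mono (φ.integrable_normed.const_mul _) hI fun u => ?_
    by_cases hu : φ.normed volume u = 0
    · simp [hu]
    · have := hsupp u hu
      rw [Real.ball_eq_Ioo] at this
      exact mul_le_mul_of_nonneg_right (hG this.1.le) (φ.nonneg_normed u)
  · rw [← hconst (G (c + φ.rOut))]
    refine integral_mono hI (φ.integrable_normed.const_mul _) fun u => ?_
    by_cases hu : φ.normed volume u = 0
    · simp [hu]
    · have := hsupp u hu
      rw [Real.ball_eq_Ioo] at this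
      exact mul_le_mul_of_nonneg_right (hG this.2.le) (φ.nonneg_normed u)

/-- Monotone functions that converge in the sense of distributions converge at every continuity
point of the limit. -/
lemma tendsto_of_tendsto_integral_smooth {Gn : ℕ → ℝ → ℝ} {G : ℝ → ℝ} (hGn : ∀ n, Monotone (Gn n))
    (hG : Monotone G)
    (h : ∀ ψ : ℝ → ℝ, ContDiff ℝ (⊤ : ℕ∞) ψ → HasCompactSupport ψ →
      Tendsto (fun n => ∫ u, Gn n u * ψ u) atTop (𝓝 (∫ u, G u * ψ u)))
    {u : ℝ} (hu : ContinuousAt G u) : Tendsto (fun n => Gn n u) atTop (𝓝 (G u)) := by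
  have hbump : ∀ d : ℝ, 0 < d → ∀ c : ℝ, ∃ φ : ContDiffBump c, φ.rOut = d := fun d hd c =>
    ⟨⟨d / 2, d, by positivity, by linarith⟩, rfl⟩
  refine tendsto_order.2 ⟨fun a ha => ?_, fun a ha => ?_⟩
  · obtain ⟨δ, hδ, hball⟩ := Metric.eventually_nhds_iff.1 (hu.eventually (lt_mem_nhds ha))
    obtain ⟨φ, hφ⟩ := hbump (δ / 4) (by positivity) (u - δ / 4)
    have h1 := h _ (φ.contDiff_normed (μ := volume)) φ.hasCompactSupport_normed
    have h2 : a < ∫ v, G v * φ.normed volume v := by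
      refine (hball ?_).trans_le (hG.integral_mul_normed_bump_mem φ).1
      rw [hφ, Real.dist_eq, abs_lt]; constructor <;> linarith
    filter_upwards [(tendsto_order.1 h1).1 a h2] with n hn
    have := ((hGn n).integral_mul_normed_bump_mem φ).2
    rw [hφ, sub_add_cancel] at this
    exact hn.trans_le this
  · obtain ⟨δ, hδ, hball⟩ := Metric.eventually_nhds_iff.1 (hu.eventually (gt_mem_nhds ha))
    obtain ⟨φ, hφ⟩ := hbump (δ / 4) (by positivity) (u + δ / 4)
    have h1 := h _ (φ.contDiff_normed (μ := volume)) φ.hasCompactSupport_normed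
    have h2 : (∫ v, G v * φ.normed volume v) < a := by
      refine (hG.integral_mul_normed_bump_mem φ).2.trans_lt (hball ?_)
      rw [hφ, Real.dist_eq, abs_lt]; constructor <;> linarith
    filter_upwards [(tendsto_order.1 h1).2 a h2] with n hn
    have := ((hGn n).integral_mul_normed_bump_mem φ).1
    rw [hφ, add_sub_cancel_right] at this
    exact this.trans_lt hn

lemma TailLike.exists_countable_tendsto {Fn : ℕ → ℝ → ℝ} (hFn : ∀ n, TailLike p q C (Fn n))
    (hF : TailLike p q C F) {σ : ℝ} (hpσ : p < σ) (hσq : σ < q)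
    (h : ∀ s : ℂ, s.re = σ → Tendsto (fun n => mellin (fun t => (Fn n t : ℂ)) s) atTop
      (𝓝 (mellin (fun t => (F t : ℂ)) s))) :
    ∃ N : Set ℝ, N.Countable ∧ ∀ t, 0 < t → t ∉ N → Tendsto (fun n => Fn n t) atTop (𝓝 (F t)) := by
  have hmono := hF.monotone_comp
  refine ⟨(fun u => Real.exp (-u)) '' {u | ¬ ContinuousAt (fun u => F (Real.exp (-u))) u},
    hmono.countable_not_continuousAt.image _, fun t ht htN => ?_⟩
  have e : Real.exp (-(-Real.log t)) = t := by rw [neg_neg, Real.exp_log ht]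
  have hc : ContinuousAt (fun u => F (Real.exp (-u))) (-Real.log t) := by
    by_contra hc
    exact htN ⟨-Real.log t, hc, e⟩
  have := tendsto_of_tendsto_integral_smooth (fun n => (hFn n).monotone_comp) hmono
    (fun ψ hψ hψc => hF.tendsto_integral_smooth hFn hpσ hσq h hψ hψc) hc
  simpa only [e] using this

end MellinInj

end Fourier

/-! ### Vague convergence from convergence on quadrants -/

/-- The quadrant with vertex `(x, y)`, parametrized by its vertex rather than by `x` and `y - x`. -/
def corner (x y : ℝ) : Set (ℝ × ℝ) := Set.Iic x ×ˢ Set.Ici y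

lemma measurableSet_corner (x y : ℝ) : MeasurableSet (corner x y) :=
  measurableSet_Iic.prod measurableSet_Ici

lemma corner_eq_quadrant (x y : ℝ) : corner x y = quadrant x (y - x) := by
  rw [corner, quadrant, add_sub_cancel]

lemma corner_inter_corner (x y x' y' : ℝ) :
    corner x y ∩ corner x' y' = corner (min x x') (max y y') := by
  rw [corner, corner, Set.prod_inter_prod, Set.Iic_inter_Iic, Set.Ici_inter_Ici, corner]

/-- The masses of the intersections of `A` with every corner whose vertex lies in `D × E`, above the
diagonal, converge. These corners are stable under intersection, which makes this property stable
under intersection with a rectangle and under removal of a rectangle. -/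
def CornerConvergent (D E : Set ℝ) (μn : ℕ → Measure (ℝ × ℝ)) (μ : Measure (ℝ × ℝ))
    (A : Set (ℝ × ℝ)) : Prop :=
  MeasurableSet A ∧ ∀ x ∈ D, ∀ y ∈ E, x < y →
    Tendsto (fun n => (μn n).real (A ∩ corner x y)) atTop (𝓝 (μ.real (A ∩ corner x y)))

section Corner

variable {D E : Set ℝ} {μn : ℕ → Measure (ℝ × ℝ)} {μ : Measure (ℝ × ℝ)} {A : Set (ℝ × ℝ)}

lemma CornerConvergent.inter_corner (hA : CornerConvergent D E μn μ A) {x y : ℝ} (hx : x ∈ D)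
    (hy : y ∈ E) (hxy : x < y) : CornerConvergent D E μn μ (A ∩ corner x y) := by
  refine ⟨hA.1.inter (measurableSet_corner x y), fun x' hx' y' hy' _ => ?_⟩
  rw [Set.inter_assoc, corner_inter_corner]
  refine hA.2 _ ?_ _ ?_ ((min_le_left _ _).trans_lt (hxy.trans_le (le_max_left _ _)))
  · rcases min_choice x x' with h | h <;> rw [h] <;> assumption
  · rcases max_choice y y' with h | h <;> rw [h] <;> assumption

lemma CornerConvergent.diff {B : Set (ℝ × ℝ)} (hA : CornerConvergent D E μn μ A)
    (hAB : CornerConvergent D E μn μ (A ∩ B)) (hB : MeasurableSet B)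
    (hfn : ∀ n x y, x < y → μn n (corner x y) ≠ ⊤) (hf : ∀ x y, x < y → μ (corner x y) ≠ ⊤) :
    CornerConvergent D E μn μ (A \ B) := by
  refine ⟨hA.1.diff hB, fun x hx y hy hxy => ?_⟩
  have e : ∀ ν : Measure (ℝ × ℝ), ν (corner x y) ≠ ⊤ → ν.real (A \ B ∩ corner x y) =
      ν.real (A ∩ corner x y) - ν.real (A ∩ B ∩ corner x y) := fun ν hν => by
    have h1 : A ∩ B ∩ corner x y = (A ∩ corner x y) ∩ B := by
      ext; simp only [Set.mem_inter_iff]; tauto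
    have h2 : A \ B ∩ corner x y = (A ∩ corner x y) \ B := by
      ext; simp only [Set.mem_inter_iff, Set.mem_sdiff]; tauto
    have := measureReal_inter_add_sdiff (μ := ν) hB (s := A ∩ corner x y)
      (measure_ne_top_of_subset Set.inter_subset_right hν)
    rw [h1, h2]; linarith
  rw [e μ (hf x y hxy)]
  simp_rw [fun n => e (μn n) (hfn n x y hxy)]
  exact (hA.2 x hx y hy hxy).sub (hAB.2 x hx y hy hxy)

/-- The half-open rectangle `]x₁, x₂] × [y₁, y₂[`, as a difference of corners. -/
def rect (x₁ x₂ y₁ y₂ : ℝ) : Set (ℝ × ℝ) := (corner x₂ y₁ \ corner x₁ y₁) \ corner x₂ y₂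

lemma mem_rect {x₁ x₂ y₁ y₂ : ℝ} {z : ℝ × ℝ} :
    z ∈ rect x₁ x₂ y₁ y₂ ↔ (x₁ < z.1 ∧ z.1 ≤ x₂) ∧ (y₁ ≤ z.2 ∧ z.2 < y₂) := by
  simp only [rect, corner, Set.mem_sdiff, Set.mem_prod, Set.mem_Iic, Set.mem_Ici, not_and, not_le]
  constructor
  · rintro ⟨⟨⟨h1, h2⟩, h3⟩, h4⟩
    exact ⟨⟨lt_of_not_ge fun h => (h3 h).not_ge h2, h1⟩, h2, h4 h1⟩
  · rintro ⟨⟨h1, h2⟩, h3, h4⟩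
    exact ⟨⟨⟨h2, h3⟩, fun h => absurd h h1.not_ge⟩, fun _ => h4⟩

lemma measurableSet_rect (x₁ x₂ y₁ y₂ : ℝ) : MeasurableSet (rect x₁ x₂ y₁ y₂) :=
  ((measurableSet_corner _ _).diff (measurableSet_corner _ _)).diff (measurableSet_corner _ _)

lemma CornerConvergent.inter_rect (hA : CornerConvergent D E μn μ A)
    (hfn : ∀ n x y, x < y → μn n (corner x y) ≠ ⊤) (hf : ∀ x y, x < y → μ (corner x y) ≠ ⊤)
    {x₁ x₂ y₁ y₂ : ℝ} (hx₁ : x₁ ∈ D) (hx₂ : x₂ ∈ D) (hy₁ : y₁ ∈ E) (hy₂ : y₂ ∈ E)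
    (h1 : x₁ < x₂) (h2 : x₂ < y₁) (h3 : y₁ < y₂) :
    CornerConvergent D E μn μ (A ∩ rect x₁ x₂ y₁ y₂) := by
  have e : A ∩ rect x₁ x₂ y₁ y₂ = ((A ∩ corner x₂ y₁) \ corner x₁ y₁) \ corner x₂ y₂ := by
    rw [rect]; ext; simp only [Set.mem_inter_iff, Set.mem_sdiff]; tauto
  have a1 := hA.inter_corner hx₂ hy₁ h2
  have a2 := a1.diff (a1.inter_corner hx₁ hy₁ (h1.trans h2)) (measurableSet_corner _ _) hfn hf
  rw [e]
  exact a2.diff (a2.inter_corner hx₂ hy₂ (h2.trans h3)) (measurableSet_corner _ _) hfn hf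

lemma exists_rect_nhds (hD : Dense D) (hE : Dense E) {z : ℝ × ℝ} (hz : z ∈ halfPlane)
    {V : Set (ℝ × ℝ)} (hV : V ∈ 𝓝 z) :
    ∃ x₁ ∈ D, ∃ x₂ ∈ D, ∃ y₁ ∈ E, ∃ y₂ ∈ E, x₁ < x₂ ∧ x₂ < y₁ ∧ y₁ < y₂ ∧
      rect x₁ x₂ y₁ y₂ ∈ 𝓝 z ∧ rect x₁ x₂ y₁ y₂ ⊆ V := by
  have hz' : z.1 < z.2 := hz
  obtain ⟨e, he, hball⟩ := Metric.mem_nhds_iff.1 hV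
  set d := min e ((z.2 - z.1) / 2) with hd
  have hd0 : 0 < d := lt_min he (by linarith)
  have hde : d ≤ e := min_le_left _ _
  have hdg : d ≤ (z.2 - z.1) / 2 := min_le_right _ _
  obtain ⟨x₁, hx₁, h1, h1'⟩ := hD.exists_between (show z.1 - d < z.1 by linarith)
  obtain ⟨x₂, hx₂, h2, h2'⟩ := hD.exists_between (show z.1 < z.1 + d by linarith)
  obtain ⟨y₁, hy₁, h3, h3'⟩ := hE.exists_between (show z.2 - d < z.2 by linarith)
  obtain ⟨y₂, hy₂, h4, h4'⟩ := hE.exists_between (show z.2 < z.2 + d by linarith)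
  refine ⟨x₁, hx₁, x₂, hx₂, y₁, hy₁, y₂, hy₂, by linarith, by linarith, by linarith, ?_, ?_⟩
  · refine mem_of_superset (prod_mem_nhds (Ioo_mem_nhds h1' h2) (Ioo_mem_nhds h3' h4))
      fun w hw => mem_rect.2 ?_
    exact ⟨⟨hw.1.1, hw.1.2.le⟩, hw.2.1.le, hw.2.2⟩
  · intro w hw
    obtain ⟨⟨a, b⟩, c, d⟩ := mem_rect.1 hw
    refine hball ?_
    rw [Metric.mem_ball, Prod.dist_eq, max_lt_iff, Real.dist_eq, Real.dist_eq, abs_lt, abs_lt]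
    refine ⟨⟨?_, ?_⟩, ?_, ?_⟩ <;> linarith

/-- `s` is a step function supported in `B`, within `b` of `f` on `B`, whose integrals converge along
`μn`; the condition on the complement of `B` allows such functions to be glued. -/
structure StepApprox (D E : Set ℝ) (μn : ℕ → Measure (ℝ × ℝ)) (μ : Measure (ℝ × ℝ))
    (f b : ℝ × ℝ → ℝ) (B : Set (ℝ × ℝ)) (s : ℝ × ℝ → ℝ) : Prop where
  diff : ∀ A, CornerConvergent D E μn μ A → CornerConvergent D E μn μ (A \ B)
  eq_zero : ∀ z ∉ B, s z = 0
  le : ∀ z ∈ B, |f z - s z| ≤ b z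
  integrable : Integrable s μ
  integrable_seq : ∀ n, Integrable s (μn n)
  tendsto : ∀ A, CornerConvergent D E μn μ A →
    Tendsto (fun n => ∫ z in A, s z ∂(μn n)) atTop (𝓝 (∫ z in A, s z ∂μ))

lemma stepApprox_rect {f b : ℝ × ℝ → ℝ}
    (hfn : ∀ n x y, x < y → μn n (corner x y) ≠ ⊤) (hf : ∀ x y, x < y → μ (corner x y) ≠ ⊤)
    {x₁ x₂ y₁ y₂ : ℝ} (hx₁ : x₁ ∈ D) (hx₂ : x₂ ∈ D) (hy₁ : y₁ ∈ E) (hy₂ : y₂ ∈ E)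
    (h1 : x₁ < x₂) (h2 : x₂ < y₁) (h3 : y₁ < y₂) (c : ℝ)
    (hc : ∀ z ∈ rect x₁ x₂ y₁ y₂, |f z - c| ≤ b z) :
    StepApprox D E μn μ f b (rect x₁ x₂ y₁ y₂) ((rect x₁ x₂ y₁ y₂).indicator fun _ => c) := by
  have hm := measurableSet_rect x₁ x₂ y₁ y₂
  have hsub : rect x₁ x₂ y₁ y₂ ⊆ corner x₂ y₁ := fun z hz => hz.1.1
  have hint : ∀ ν : Measure (ℝ × ℝ), ν (corner x₂ y₁) ≠ ⊤ →
      Integrable ((rect x₁ x₂ y₁ y₂).indicator fun _ => c) ν := fun ν hν =>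
    (integrable_indicator_iff hm).2 (integrableOn_const (measure_ne_top_of_subset hsub hν))
  refine ⟨fun A hA => hA.diff (hA.inter_rect hfn hf hx₁ hx₂ hy₁ hy₂ h1 h2 h3) hm hfn hf,
    fun z hz => Set.indicator_of_notMem hz _, fun z hz => ?_, hint μ (hf _ _ h2),
    fun n => hint _ (hfn n _ _ h2), fun A hA => ?_⟩
  · rw [Set.indicator_of_mem hz]; exact hc z hz
  · have e : ∀ ν : Measure (ℝ × ℝ), ∫ z in A, (rect x₁ x₂ y₁ y₂).indicator (fun _ => c) z ∂ν =
        ν.real (A ∩ rect x₁ x₂ y₁ y₂ ∩ corner x₂ y₁) * c := fun ν => by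
      rw [setIntegral_indicator hm, setIntegral_const, smul_eq_mul,
        Set.inter_eq_left.2 (Set.inter_subset_right.trans hsub)]
    simp_rw [e]
    exact ((hA.inter_rect hfn hf hx₁ hx₂ hy₁ hy₂ h1 h2 h3).2 _ hx₂ _ hy₁ h2).mul_const c

lemma StepApprox.union {f b : ℝ × ℝ → ℝ} {B₁ B₂ : Set (ℝ × ℝ)} {s₁ s₂ : ℝ × ℝ → ℝ}
    (h₁ : StepApprox D E μn μ f b B₁ s₁) (h₂ : StepApprox D E μn μ f b B₂ s₂)
    (hB₁ : MeasurableSet B₁) :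
    StepApprox D E μn μ f b (B₁ ∪ B₂) fun z => s₁ z + B₁ᶜ.indicator s₂ z := by
  refine ⟨fun A hA => ?_, fun z hz => ?_, fun z hz => ?_,
    h₁.integrable.add (h₂.integrable.indicator hB₁.compl),
    fun n => (h₁.integrable_seq n).add ((h₂.integrable_seq n).indicator hB₁.compl),
    fun A hA => ?_⟩
  · have : A \ (B₁ ∪ B₂) = (A \ B₁) \ B₂ := by
      ext; simp only [Set.mem_sdiff, Set.mem_union]; tauto
    rw [this]
    exact h₂.diff _ (h₁.diff _ hA)
  · have h : z ∉ B₁ ∧ z ∉ B₂ := by simpa using hz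
    rw [h₁.eq_zero z h.1, Set.indicator_of_mem h.1, h₂.eq_zero z h.2, add_zero]
  · by_cases hz1 : z ∈ B₁
    · rw [Set.indicator_of_notMem (Set.notMem_compl_iff.2 hz1), add_zero]; exact h₁.le z hz1
    · rw [h₁.eq_zero z hz1, Set.indicator_of_mem hz1, zero_add]
      exact h₂.le z (hz.resolve_left hz1)
  · have e : ∀ ν : Measure (ℝ × ℝ), Integrable s₁ ν → Integrable s₂ ν →
        ∫ z in A, (s₁ z + B₁ᶜ.indicator s₂ z) ∂ν =
          ∫ z in A, s₁ z ∂ν + ∫ z in A \ B₁, s₂ z ∂ν := fun ν i1 i2 => by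
      rw [integral_add i1.integrableOn (i2.indicator hB₁.compl).integrableOn,
        setIntegral_indicator hB₁.compl]
      rfl
    rw [e μ h₁.integrable h₂.integrable]
    simp_rw [fun n => e (μn n) (h₁.integrable_seq n) (h₂.integrable_seq n)]
    exact (h₁.tendsto A hA).add (h₂.tendsto _ (h₁.diff _ hA))

/-- The approximation exists near every point of the half-plane and can be glued along finite unions,
hence it exists on compact sets. -/
lemma exists_stepApprox (hD : Dense D) (hE : Dense E)
    (hfn : ∀ n x y, x < y → μn n (corner x y) ≠ ⊤) (hf : ∀ x y, x < y → μ (corner x y) ≠ ⊤)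
    {f b : ℝ × ℝ → ℝ} (hfc : Continuous f) (hb : Continuous b) (hb0 : ∀ z ∈ halfPlane, 0 < b z)
    {K : Set (ℝ × ℝ)} (hK : IsCompact K) (hKs : K ⊆ halfPlane) :
    ∃ B s, MeasurableSet B ∧ K ⊆ B ∧ StepApprox D E μn μ f b B s := by
  refine hK.induction_on (p := fun K => ∃ B s, MeasurableSet B ∧ K ⊆ B ∧
    StepApprox D E μn μ f b B s) ?_ ?_ ?_ ?_
  · refine ⟨∅, 0, .empty, subset_rfl, fun A hA => by simpa using hA, fun _ _ => rfl,
      fun z hz => hz.elim, integrable_zero _ _ _, fun n => integrable_zero _ _ _, fun A hA => ?_⟩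
    simp
  · rintro S T hST ⟨B, s, hB, hTB, h⟩
    exact ⟨B, s, hB, hST.trans hTB, h⟩
  · rintro S T ⟨B, s, hB, hSB, h⟩ ⟨B', s', hB', hTB', h'⟩
    exact ⟨B ∪ B', _, hB.union hB', Set.union_subset_union hSB hTB', h.union h' hB⟩
  · intro z hz
    have hV : {w | |f w - f z| < b w} ∈ 𝓝 z := by
      refine (isOpen_lt (by fun_prop) hb).mem_nhds ?_
      simpa using hb0 z (hKs hz)
    obtain ⟨x₁, hx₁, x₂, hx₂, y₁, hy₁, y₂, hy₂, h1, h2, h3, hR, hRV⟩ :=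
      exists_rect_nhds hD hE (hKs hz) hV
    refine ⟨_, mem_nhdsWithin_of_mem_nhds hR, _, _, measurableSet_rect _ _ _ _, subset_rfl,
      stepApprox_rect hfn hf hx₁ hx₂ hy₁ hy₂ h1 h2 h3 (f z) fun w hw => ?_⟩
    exact (show |f w - f z| < b w from hRV hw).le

end Corner

/-- A test function is approximated by step functions up to a small multiple of `gap ^ r`, whose
integrals are bounded uniformly in `n`. -/
lemma vagueTendsto_of_tendsto_corner {D E : Set ℝ} (hD : Dense D) (hE : Dense E)
    {p q C r : ℝ} (hp : 0 < p) (hpr : p < r) (hrq : r < q)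
    {μn : ℕ → Measure (ℝ × ℝ)} {μ : Measure (ℝ × ℝ)} (hμn : ∀ n, TailBound p q C (μn n))
    (hμ : TailBound p q C μ)
    (h : ∀ x ∈ D, ∀ y ∈ E, x < y →
      Tendsto (fun n => (μn n).real (corner x y)) atTop (𝓝 (μ.real (corner x y)))) :
    VagueTendsto μn μ := by
  intro f hf hfc hfs
  have hr := hp.trans hpr
  obtain ⟨M, hM, hE'⟩ := TailBound.exists_energy_le hp hpr hrq C
  have hfin : ∀ ν : Measure (ℝ × ℝ), TailBound p q C ν → ∀ x y, x < y → ν (corner x y) ≠ ⊤ :=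
    fun ν hν x y hxy => by
      rw [corner_eq_quadrant]; exact (hν.quadrant_lt_top x (sub_pos.2 hxy)).ne
  have huniv : CornerConvergent D E μn μ Set.univ := ⟨.univ, by simpa using h⟩
  have hf0 := eq_zero_of_notMem_halfPlane hfs
  have hctrl := energyControlled_of_hasCompactSupport hr hf hfc hfs
  refine Metric.tendsto_nhds.2 fun ε hε => ?_
  set η := ε / (3 * (M.toReal + 1)) with hη
  have hM0 : 0 ≤ M.toReal := ENNReal.toReal_nonneg
  have hη0 : 0 < η := by positivity
  obtain ⟨B, s, hB, hKB, hs⟩ := exists_stepApprox (f := f) (b := fun z => η * gap z ^ r) hD hE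
    (fun n => hfin _ (hμn n)) (hfin _ hμ) hf
    (continuous_const.mul (continuous_gap.rpow_const fun _ => Or.inr hr.le))
    (fun z hz => mul_pos hη0 (Real.rpow_pos_of_pos (gap_pos_iff.2 hz) _)) hfc.isCompact hfs
  have happrox : ∀ ν : Measure (ℝ × ℝ), TailBound p q C ν → Integrable s ν →
      dist (∫ z, f z ∂ν) (∫ z, s z ∂ν) < ε / 3 := fun ν hν hsν => by
    have hfin := (hE' ν hν).trans_lt hM.lt_top
    rw [dist_eq_norm, ← integral_sub (hctrl.integrable hr hf.measurable hf0 hfin) hsν]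
    calc _ ≤ ∫ z, η * gap z ^ r ∂ν := by
          refine norm_integral_le_of_norm_le ((integrable_gap_rpow hfin).const_mul η)
            (ae_of_all _ fun z => ?_)
          by_cases hz : z ∈ B
          · exact hs.le z hz
          · rw [hs.eq_zero z hz, image_eq_zero_of_notMem_tsupport fun h => hz (hKB h), sub_zero,
              norm_zero]
            have := Real.rpow_nonneg (gap_nonneg z) r
            positivity
      _ = η * (energy r ν).toReal := by rw [integral_const_mul, integral_gap_rpow]
      _ ≤ η * M.toReal := by
          gcongr
          exact hE' ν hν
      _ < ε / 3 := by
          rw [hη, div_mul_eq_mul_div, div_lt_div_iff₀ (by positivity) (by norm_num)]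
          nlinarith
  have hlim := hs.tendsto _ huniv
  simp only [Measure.restrict_univ] at hlim
  filter_upwards [Metric.tendsto_nhds.1 hlim (ε / 3) (by positivity)] with n hn
  have h1 := happrox _ (hμn n) (hs.integrable_seq n)
  have h2 := happrox μ hμ hs.integrable
  rw [dist_comm] at h2
  have h3 := dist_triangle4 (∫ z, f z ∂(μn n)) (∫ z, s z ∂(μn n)) (∫ z, s z ∂μ) (∫ z, f z ∂μ)
  linarith

/-- Countably many good abscissas suffice, so that the ordinates to be avoided still form a countable
set. -/
lemma vagueTendsto_of_tendsto_localZeta {p q C r : ℝ} (hp : 0 < p) (hpr : p < r) (hrq : r < q)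
    (hC : 0 ≤ C) {μn : ℕ → Measure (ℝ × ℝ)} {μ : Measure (ℝ × ℝ)}
    (hμn : ∀ n, TailBound p q C (μn n)) (hμ : TailBound p q C μ)
    (h : ∀ᵐ x : ℝ, ∀ s : ℂ, s.re = r →
      Tendsto (fun n => localZeta (μn n) x s) atTop (𝓝 (localZeta μ x s))) :
    VagueTendsto μn μ := by
  have hpq := hpr.trans hrq
  have h' : ∀ᵐ x : ℝ, ∃ N : Set ℝ, N.Countable ∧ ∀ t, 0 < t → t ∉ N →
      Tendsto (fun n => (μn n).real (quadrant x t)) atTop (𝓝 (μ.real (quadrant x t))) := by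
    filter_upwards [h] with x hx
    refine (hμ.tailLike_quadrant hpq hC x).exists_countable_tendsto
      (fun n => (hμn n).tailLike_quadrant hpq hC x) hpr hrq fun s hs => ?_
    have hs0 : s ≠ 0 := fun h0 => by rw [h0, Complex.zero_re] at hs; linarith
    have := (hx s hs).const_mul s⁻¹
    simpa only [localZeta, inv_mul_cancel_left₀ hs0] using this
  obtain ⟨D, hDs, hDc, hD⟩ := (Measure.dense_of_ae h').exists_countable_dense_subset
  have hDs' : ∀ x ∈ D, ∃ N : Set ℝ, N.Countable ∧ ∀ t, 0 < t → t ∉ N →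
      Tendsto (fun n => (μn n).real (quadrant x t)) atTop (𝓝 (μ.real (quadrant x t))) :=
    fun x hx => hDs hx
  choose! N hNc hN using hDs'
  have hEc : (⋃ x ∈ D, (fun t => x + t) '' N x).Countable :=
    hDc.biUnion fun x hx => (hNc x hx).image _
  refine vagueTendsto_of_tendsto_corner hD (hEc.dense_compl ℝ) hp hpr hrq hμn hμ
    fun x hx y hy hxy => ?_
  simp only [corner_eq_quadrant]
  refine hN x hx (y - x) (sub_pos.2 hxy) fun hyN => hy ?_
  exact Set.mem_biUnion hx ⟨y - x, hyN, by ring⟩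

/-! ### Gluing transport plans and the cost of a small cell -/

lemma add_mem_transportPlans {μ₁ μ₂ ν₁ ν₂ : Measure (ℝ × ℝ)}
    {π₁ π₂ : Measure ((ℝ × ℝ) × (ℝ × ℝ))} (h₁ : π₁ ∈ transportPlans μ₁ ν₁)
    (h₂ : π₂ ∈ transportPlans μ₂ ν₂) : π₁ + π₂ ∈ transportPlans (μ₁ + μ₂) (ν₁ + ν₂) := by
  refine ⟨?_, fun A hA hAs => ?_, fun A hA hAs => ?_⟩
  · simp only [Measure.add_apply, h₁.1, h₂.1, add_zero]
  · simp only [Measure.add_apply, h₁.2.1 A hA hAs, h₂.2.1 A hA hAs]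
  · simp only [Measure.add_apply, h₁.2.2 A hA hAs, h₂.2.2 A hA hAs]

lemma cost_add_le (r : ℝ) (μ₁ μ₂ ν₁ ν₂ : Measure (ℝ × ℝ)) :
    cost r (μ₁ + μ₂) (ν₁ + ν₂) ≤ cost r μ₁ ν₁ + cost r μ₂ ν₂ := by
  have : cost r μ₁ ν₁ + cost r μ₂ ν₂ = ⨅ (π₁ : transportPlans μ₁ ν₁) (π₂ : transportPlans μ₂ ν₂),
      (∫⁻ z, edist z.1 z.2 ^ r ∂(π₁ : Measure ((ℝ × ℝ) × (ℝ × ℝ))) +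
        ∫⁻ z, edist z.1 z.2 ^ r ∂(π₂ : Measure ((ℝ × ℝ) × (ℝ × ℝ)))) := by
    simp_rw [cost, iInf_subtype', ENNReal.iInf_add, ENNReal.add_iInf]
  rw [this]
  refine le_iInf₂ fun π₁ π₂ => (iInf₂_le _ (add_mem_transportPlans π₁.2 π₂.2)).trans ?_
  rw [lintegral_add_measure]

lemma cost_zero_zero (r : ℝ) : cost r 0 0 = 0 := by
  refine le_antisymm ((iInf₂_le 0 ⟨?_, fun _ _ _ => ?_, fun _ _ _ => ?_⟩).trans ?_) zero_le <;> simp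

lemma cost_sum_le (r : ℝ) {ι : Type*} (s : Finset ι) (μ ν : ι → Measure (ℝ × ℝ)) :
    cost r (∑ i ∈ s, μ i) (∑ i ∈ s, ν i) ≤ ∑ i ∈ s, cost r (μ i) (ν i) := by
  classical
  induction s using Finset.induction_on with
  | empty => simp [cost_zero_zero]
  | insert i s hi ih =>
    rw [Finset.sum_insert hi, Finset.sum_insert hi, Finset.sum_insert hi]
    exact (cost_add_le _ _ _ _ _).trans (by gcongr)

lemma cost_zero_right_le {r : ℝ} (hr : 0 < r) {μ : Measure (ℝ × ℝ)} (hμ : μ halfPlaneᶜ = 0) :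
    cost r μ 0 ≤ energy r μ := by
  have hm : Measurable fun z : ℝ × ℝ => (z, diagProj z) := by
    have := continuous_diagProj.measurable
    fun_prop
  have hae : ∀ᵐ z ∂μ, z ∈ halfPlane := hμ
  have hmem : (μ.map fun z => (z, diagProj z)) ∈ transportPlans μ 0 := by
    refine ⟨?_, fun A hA hAs => ?_, fun A hA hAs => ?_⟩
    · rw [Measure.map_apply hm
        (measurableSet_closedHalfPlane.prod measurableSet_closedHalfPlane).compl]
      refine measure_mono_null (t := halfPlaneᶜ) (fun z hz => ?_) hμ
      exact fun hz' => hz ⟨halfPlane_subset_closed hz', diagProj_mem_closed z⟩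
    · rw [Measure.map_apply hm (measurable_fst hA)]; rfl
    · rw [Measure.map_apply hm (measurable_snd hA), Measure.coe_zero, Pi.zero_apply]
      have : (fun z => (z, diagProj z)) ⁻¹' (Prod.snd ⁻¹' A) = ∅ :=
        Set.eq_empty_of_forall_notMem fun z hz => diagProj_notMem z (hAs hz)
      rw [this, measure_empty]
  refine (iInf₂_le _ hmem).trans ?_
  rw [lintegral_map (by fun_prop) hm, energy]
  refine lintegral_mono_ae ?_
  filter_upwards [hae] with z hz
  rw [edist_rpow hr.le, dist_diagProj hz]

/-- Two measures of equal finite mass are coupled by their normalized product. If the mass is `0`, the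
convention `∞ * 0 = 0` makes the formula correct. -/
lemma prod_mem_transportPlans {μ ν : Measure (ℝ × ℝ)} [IsFiniteMeasure μ] [IsFiniteMeasure ν]
    (hμ : μ halfPlaneᶜ = 0) (hν : ν halfPlaneᶜ = 0) (hmass : μ Set.univ = ν Set.univ) :
    (μ Set.univ)⁻¹ • μ.prod ν ∈ transportPlans μ ν := by
  have key : ∀ (ρ : Measure (ℝ × ℝ)) [IsFiniteMeasure ρ] (A : Set (ℝ × ℝ)),
      (ρ Set.univ)⁻¹ * (ρ A * ρ Set.univ) = ρ A := fun ρ _ A => by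
    rcases eq_or_ne (ρ Set.univ) 0 with h | h
    · rw [measure_mono_null (Set.subset_univ A) h]; simp
    · rw [mul_comm, mul_assoc, ENNReal.mul_inv_cancel h (measure_ne_top _ _), mul_one]
  refine ⟨?_, fun A hA hAs => ?_, fun A hA hAs => ?_⟩
  · rw [Measure.smul_apply, smul_eq_mul]
    have : (μ.prod ν) (closedHalfPlane ×ˢ closedHalfPlane)ᶜ = 0 := by
      refine measure_mono_null (t := halfPlaneᶜ ×ˢ Set.univ ∪ Set.univ ×ˢ halfPlaneᶜ)
        (fun z hz => ?_) (measure_union_null ?_ ?_)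
      · by_contra h
        simp only [Set.mem_union, Set.mem_prod, Set.mem_compl_iff, Set.mem_univ, and_true,
          true_and, not_or, not_not] at h
        exact hz ⟨halfPlane_subset_closed h.1, halfPlane_subset_closed h.2⟩
      · rw [Measure.prod_prod, hμ, zero_mul]
      · rw [Measure.prod_prod, hν, mul_zero]
    rw [this, mul_zero]
  · rw [Measure.smul_apply, smul_eq_mul, ← Set.prod_univ, Measure.prod_prod, ← hmass, key]
  · rw [Measure.smul_apply, smul_eq_mul, ← Set.univ_prod, Measure.prod_prod, hmass,
      mul_comm (ν Set.univ), key]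

/-- On a set whose diameter is small compared with the distance to the diagonal, any coupling is cheap
relative to the energy. -/
lemma cost_le_of_mass_eq {r κ : ℝ} (hr : 0 < r) (hκ : 0 ≤ κ) {U : Set (ℝ × ℝ)}
    (hU : ∀ z ∈ U, ∀ w ∈ U, dist z w ≤ κ * gap z)
    {μ ν : Measure (ℝ × ℝ)} [IsFiniteMeasure μ] [IsFiniteMeasure ν]
    (hμ : μ halfPlaneᶜ = 0) (hν : ν halfPlaneᶜ = 0) (hμU : μ Uᶜ = 0) (hνU : ν Uᶜ = 0)
    (hmass : μ Set.univ = ν Set.univ) :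
    cost r μ ν ≤ ENNReal.ofReal (κ ^ r) * energy r μ := by
  refine (iInf₂_le _ (prod_mem_transportPlans hμ hν hmass)).trans ?_
  have hae1 : ∀ᵐ z ∂(μ.prod ν), z.1 ∈ U := Measure.quasiMeasurePreserving_fst.ae hμU
  have hae2 : ∀ᵐ z ∂(μ.prod ν), z.2 ∈ U := Measure.quasiMeasurePreserving_snd.ae hνU
  have hle : ∫⁻ z, edist z.1 z.2 ^ r ∂(μ.prod ν) ≤
      ENNReal.ofReal (κ ^ r) * energy r μ * μ Set.univ := by
    calc _ ≤ ∫⁻ z, ENNReal.ofReal (κ ^ r) * ENNReal.ofReal (gap z.1 ^ r) * 1 ∂(μ.prod ν) := by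
          refine lintegral_mono_ae ?_
          filter_upwards [hae1, hae2] with z h1 h2
          rw [edist_rpow hr.le, mul_one, ← ENNReal.ofReal_mul (by positivity),
            ← Real.mul_rpow hκ (gap_nonneg _)]
          gcongr
          exact hU _ h1 _ h2
      _ = (∫⁻ z, ENNReal.ofReal (κ ^ r) * ENNReal.ofReal (gap z ^ r) ∂μ) * ∫⁻ _, 1 ∂ν :=
          lintegral_prod_mul ((measurable_gap_rpow r).const_mul _).aemeasurable
            aemeasurable_const
      _ = _ := by
          rw [lintegral_const_mul _ (measurable_gap_rpow r), lintegral_one, hmass, energy]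
  rw [lintegral_smul_measure, smul_eq_mul]
  rcases eq_or_ne (μ Set.univ) 0 with h | h
  · rw [h, mul_zero, nonpos_iff_eq_zero] at hle
    rw [hle, mul_zero]; exact zero_le
  · calc _ ≤ (μ Set.univ)⁻¹ * (ENNReal.ofReal (κ ^ r) * energy r μ * μ Set.univ) := by gcongr
      _ = _ := by
          rw [mul_comm, mul_assoc, ENNReal.mul_inv_cancel h (measure_ne_top _ _), mul_one]

lemma energy_le_mul_mass {r B : ℝ} {U : Set (ℝ × ℝ)} (hB : ∀ z ∈ U, gap z ^ r ≤ B)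
    {μ : Measure (ℝ × ℝ)} (hμU : μ Uᶜ = 0) : energy r μ ≤ ENNReal.ofReal B * μ Set.univ := by
  have hae : ∀ᵐ z ∂μ, z ∈ U := hμU
  rw [energy, ← lintegral_const]
  refine lintegral_mono_ae ?_
  filter_upwards [hae] with z hz
  exact ENNReal.ofReal_le_ofReal (hB z hz)

lemma energy_smul (r : ℝ) (c : ENNReal) (μ : Measure (ℝ × ℝ)) :
    energy r (c • μ) = c * energy r μ := by
  rw [energy, lintegral_smul_measure, smul_eq_mul, energy]

/-- The surplus mass of `ν` is sent to the diagonal. -/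
lemma cost_le_of_mass_le {r κ B : ℝ} (hr : 0 < r) (hκ : 0 ≤ κ) {U : Set (ℝ × ℝ)}
    (hU : ∀ z ∈ U, ∀ w ∈ U, dist z w ≤ κ * gap z) (hB : ∀ z ∈ U, gap z ^ r ≤ B)
    {μ ν : Measure (ℝ × ℝ)} [IsFiniteMeasure μ] [IsFiniteMeasure ν]
    (hμ : μ halfPlaneᶜ = 0) (hν : ν halfPlaneᶜ = 0) (hμU : μ Uᶜ = 0) (hνU : ν Uᶜ = 0)
    (hmass : μ Set.univ ≤ ν Set.univ) :
    cost r μ ν ≤ ENNReal.ofReal (κ ^ r) * energy r μ +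
      ENNReal.ofReal B * (ν Set.univ - μ Set.univ) := by
  rcases eq_or_ne (ν Set.univ) 0 with h0 | h0
  · have h1 : μ = 0 := Measure.measure_univ_eq_zero.1 (le_antisymm (hmass.trans h0.le) zero_le)
    have h2 : ν = 0 := Measure.measure_univ_eq_zero.1 h0
    rw [h1, h2, cost_zero_zero]; exact zero_le
  set β := μ Set.univ / ν Set.univ with hβ
  have hβ1 : β ≤ 1 := ENNReal.div_le_of_le_mul (by rwa [one_mul])
  have hβν : β * ν Set.univ = μ Set.univ := ENNReal.div_mul_cancel h0 (measure_ne_top _ _)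
  have hsum : β • ν + (1 - β) • ν = ν := by
    rw [← add_smul, add_tsub_cancel_of_le hβ1, one_smul]
  have : IsFiniteMeasure (β • ν) := ⟨by
    rw [Measure.smul_apply, smul_eq_mul, hβν]; exact measure_lt_top _ _⟩
  have hnull : ∀ (c : ENNReal) {s : Set (ℝ × ℝ)}, ν s = 0 → (c • ν) s = 0 := fun c s hs => by
    rw [Measure.smul_apply, hs, smul_zero]
  calc cost r μ ν = cost r (μ + 0) (β • ν + (1 - β) • ν) := by rw [hsum, add_zero]
    _ ≤ cost r μ (β • ν) + cost r 0 ((1 - β) • ν) := cost_add_le _ _ _ _ _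
    _ ≤ _ := by
        refine add_le_add (cost_le_of_mass_eq hr hκ hU hμ (hnull _ hν) hμU (hnull _ hνU) ?_) ?_
        · rw [Measure.smul_apply, smul_eq_mul, hβν]
        · rw [cost_comm]
          refine (cost_zero_right_le hr (hnull _ hν)).trans ?_
          rw [energy_smul]
          refine (mul_le_mul_right (energy_le_mul_mass hB hνU) _).trans (le_of_eq ?_)
          rw [mul_left_comm, ENNReal.sub_mul (fun _ _ => measure_ne_top _ _), one_mul, hβν]

/-- The truncated differences add up to the absolute difference of the two masses. -/
lemma cost_le_of_cell {r κ B : ℝ} (hr : 0 < r) (hκ : 0 ≤ κ) {U : Set (ℝ × ℝ)}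
    (hU : ∀ z ∈ U, ∀ w ∈ U, dist z w ≤ κ * gap z) (hB : ∀ z ∈ U, gap z ^ r ≤ B)
    {μ ν : Measure (ℝ × ℝ)} [IsFiniteMeasure μ] [IsFiniteMeasure ν]
    (hμ : μ halfPlaneᶜ = 0) (hν : ν halfPlaneᶜ = 0) (hμU : μ Uᶜ = 0) (hνU : ν Uᶜ = 0) :
    cost r μ ν ≤ ENNReal.ofReal (κ ^ r) * (energy r μ + energy r ν) +
      ENNReal.ofReal B * ((μ Set.univ - ν Set.univ) + (ν Set.univ - μ Set.univ)) := by
  rcases le_total (μ Set.univ) (ν Set.univ) with h | h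
  · refine (cost_le_of_mass_le hr hκ hU hB hμ hν hμU hνU h).trans ?_
    gcongr
    · exact le_self_add
    · exact le_add_self
  · rw [cost_comm]
    refine (cost_le_of_mass_le hr hκ hU hB hν hμ hνU hμU h).trans ?_
    gcongr
    · exact le_add_self
    · exact le_self_add

/-! ### Partition of the transport problem into cells -/

section Partition

variable {ι : Type*} [Fintype ι] {φ : ι → ℝ × ℝ → ℝ}

lemma sum_withDensity_add (hc : ∀ i, Continuous (φ i)) (h0 : ∀ i z, 0 ≤ φ i z)
    (h1 : ∀ z, ∑ i, φ i z ≤ 1) (μ : Measure (ℝ × ℝ)) :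
    ∑ i, μ.withDensity (fun z => ENNReal.ofReal (φ i z)) +
      μ.withDensity (fun z => ENNReal.ofReal (1 - ∑ i, φ i z)) = μ := by
  have hm : ∀ i, Measurable (φ i) := fun i => (hc i).measurable
  ext s hs
  rw [Measure.add_apply, Measure.finsetSum_apply]
  simp_rw [withDensity_apply _ hs]
  rw [← lintegral_finsetSum _ (fun i _ => (hm i).ennreal_ofReal),
    ← lintegral_add_left (Finset.measurable_sum _ fun i _ => (hm i).ennreal_ofReal)]
  have : ∀ z, ∑ i, ENNReal.ofReal (φ i z) + ENNReal.ofReal (1 - ∑ i, φ i z) = 1 := fun z => by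
    rw [← ENNReal.ofReal_sum_of_nonneg fun i _ => h0 i z,
      ← ENNReal.ofReal_add (Finset.sum_nonneg fun i _ => h0 i z) (by linarith [h1 z])]
    simp
  simp_rw [this]
  simp

lemma energy_withDensity (r : ℝ) {f : ℝ × ℝ → ℝ} (hf : Continuous f) (μ : Measure (ℝ × ℝ)) :
    energy r (μ.withDensity fun z => ENNReal.ofReal (f z)) =
      ∫⁻ z, ENNReal.ofReal (f z) * ENNReal.ofReal (gap z ^ r) ∂μ := by
  rw [energy, lintegral_withDensity_eq_lintegral_mul _ hf.measurable.ennreal_ofReal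
    (measurable_gap_rpow r)]
  rfl

lemma energy_add (r : ℝ) (μ ν : Measure (ℝ × ℝ)) : energy r (μ + ν) = energy r μ + energy r ν :=
  lintegral_add_measure _ _ _

lemma energy_sum (r : ℝ) (μ : ι → Measure (ℝ × ℝ)) : energy r (∑ i, μ i) = ∑ i, energy r (μ i) :=
  lintegral_finsetSum_measure _ _ _

/-- The pieces cut out by the `φ i` are matched cell by cell; what is left is sent to the diagonal. -/
lemma cost_le_of_partition {r κ : ℝ} (hr : 0 < r) (hκ : 0 ≤ κ) (hc : ∀ i, Continuous (φ i))
    (h0 : ∀ i z, 0 ≤ φ i z) (h1 : ∀ z, ∑ i, φ i z ≤ 1) {U : ι → Set (ℝ × ℝ)} {B : ι → ℝ}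
    (hφU : ∀ i, ∀ z ∉ U i, φ i z = 0)
    (hU : ∀ i, ∀ z ∈ U i, ∀ w ∈ U i, dist z w ≤ κ * gap z)
    (hB : ∀ i, ∀ z ∈ U i, gap z ^ r ≤ B i)
    {μ ν : Measure (ℝ × ℝ)} (hμ : μ halfPlaneᶜ = 0) (hν : ν halfPlaneᶜ = 0)
    (hμφ : ∀ i, ∫⁻ z, ENNReal.ofReal (φ i z) ∂μ ≠ ⊤)
    (hνφ : ∀ i, ∫⁻ z, ENNReal.ofReal (φ i z) ∂ν ≠ ⊤) :
    cost r μ ν ≤ ENNReal.ofReal (κ ^ r) * (energy r μ + energy r ν) +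
      ∑ i, ENNReal.ofReal (B i) *
        ((∫⁻ z, ENNReal.ofReal (φ i z) ∂μ - ∫⁻ z, ENNReal.ofReal (φ i z) ∂ν) +
          (∫⁻ z, ENNReal.ofReal (φ i z) ∂ν - ∫⁻ z, ENNReal.ofReal (φ i z) ∂μ)) +
      (∫⁻ z, ENNReal.ofReal (1 - ∑ i, φ i z) * ENNReal.ofReal (gap z ^ r) ∂μ +
        ∫⁻ z, ENNReal.ofReal (1 - ∑ i, φ i z) * ENNReal.ofReal (gap z ^ r) ∂ν) := by
  have hcr : Continuous fun z => 1 - ∑ i, φ i z := by fun_prop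
  have hnull : ∀ (f : ℝ × ℝ → ENNReal) {ρ : Measure (ℝ × ℝ)} {s : Set (ℝ × ℝ)}, ρ s = 0 →
      ρ.withDensity f s = 0 := fun f ρ s hs => withDensity_absolutelyContinuous ρ f hs
  have hnullU : ∀ (i : ι) (ρ : Measure (ℝ × ℝ)),
      ρ.withDensity (fun z => ENNReal.ofReal (φ i z)) (U i)ᶜ = 0 := fun i ρ => by
    refine measure_mono_null (t := {z | ENNReal.ofReal (φ i z) = 0}) (fun z hz => ?_) ?_
    · simp [hφU i z hz]
    · rw [withDensity_apply _ (measurableSet_eq_fun (hc i).measurable.ennreal_ofReal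
        measurable_const), setLIntegral_eq_zero_iff (measurableSet_eq_fun
          (hc i).measurable.ennreal_ofReal measurable_const) (hc i).measurable.ennreal_ofReal]
      exact ae_of_all _ fun z hz => hz
  have huniv : ∀ (i : ι) (ρ : Measure (ℝ × ℝ)),
      ρ.withDensity (fun z => ENNReal.ofReal (φ i z)) Set.univ =
        ∫⁻ z, ENNReal.ofReal (φ i z) ∂ρ := fun i ρ => by
    rw [withDensity_apply _ MeasurableSet.univ, Measure.restrict_univ]
  have hE : ∀ ρ : Measure (ℝ × ℝ),
      ∑ i, energy r (ρ.withDensity (fun z => ENNReal.ofReal (φ i z))) ≤ energy r ρ := fun ρ => by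
    conv_rhs => rw [← sum_withDensity_add hc h0 h1 ρ, energy_add, energy_sum]
    exact le_self_add
  conv_lhs => rw [← sum_withDensity_add hc h0 h1 μ, ← sum_withDensity_add hc h0 h1 ν]
  refine (cost_add_le _ _ _ _ _).trans (add_le_add ?_ ?_)
  · refine (cost_sum_le r Finset.univ _ _).trans ?_
    calc _ ≤ ∑ i, (ENNReal.ofReal (κ ^ r) *
          (energy r (μ.withDensity (fun z => ENNReal.ofReal (φ i z))) +
            energy r (ν.withDensity (fun z => ENNReal.ofReal (φ i z)))) +
          ENNReal.ofReal (B i) *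
            ((∫⁻ z, ENNReal.ofReal (φ i z) ∂μ - ∫⁻ z, ENNReal.ofReal (φ i z) ∂ν) +
              (∫⁻ z, ENNReal.ofReal (φ i z) ∂ν - ∫⁻ z, ENNReal.ofReal (φ i z) ∂μ))) := by
          refine Finset.sum_le_sum fun i _ => ?_
          have f1 : IsFiniteMeasure (μ.withDensity fun z => ENNReal.ofReal (φ i z)) :=
            isFiniteMeasure_withDensity (hμφ i)
          have f2 : IsFiniteMeasure (ν.withDensity fun z => ENNReal.ofReal (φ i z)) :=
            isFiniteMeasure_withDensity (hνφ i)
          rw [← huniv i μ, ← huniv i ν]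
          exact cost_le_of_cell hr hκ (hU i) (hB i) (hnull _ hμ) (hnull _ hν) (hnullU i μ)
            (hnullU i ν)
      _ ≤ _ := by
          rw [Finset.sum_add_distrib, ← Finset.mul_sum, Finset.sum_add_distrib]
          gcongr <;> exact hE _
  · rw [← energy_withDensity r hcr, ← energy_withDensity r hcr]
    calc _ = cost r (μ.withDensity (fun z => ENNReal.ofReal (1 - ∑ i, φ i z)) + 0)
          (0 + ν.withDensity (fun z => ENNReal.ofReal (1 - ∑ i, φ i z))) := by simp
      _ ≤ _ := (cost_add_le _ _ _ _ _).trans (add_le_add (cost_zero_right_le hr (hnull _ hμ))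
          ((cost_comm r _ _).trans_le (cost_zero_right_le hr (hnull _ hν))))

end Partition

/-- The cells are balls of radius `κ * gap i` around finitely many points `i` of `K`. -/
lemma exists_partition {κ : ℝ} (hκ : 0 < κ) (hκ1 : κ ≤ 1 / 2) {K : Set (ℝ × ℝ)} (hK : IsCompact K)
    (hKs : K ⊆ halfPlane) :
    ∃ (t : Finset (ℝ × ℝ)) (φ : t → ℝ × ℝ → ℝ) (U : t → Set (ℝ × ℝ)),
      (∀ i, Continuous (φ i)) ∧ (∀ i z, 0 ≤ φ i z) ∧ (∀ z, ∑ i, φ i z ≤ 1) ∧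
      (∀ z ∈ K, ∑ i, φ i z = 1) ∧ (∀ i, HasCompactSupport (φ i)) ∧
      (∀ i, tsupport (φ i) ⊆ halfPlane) ∧ (∀ i, ∀ z ∉ U i, φ i z = 0) ∧
      (∀ i, ∀ z ∈ U i, ∀ w ∈ U i, dist z w ≤ 4 * κ * gap z) ∧
      (∀ i, ∃ G, ∀ z ∈ U i, gap z ≤ G) := by
  obtain ⟨t, htK, ht⟩ := hK.elim_nhds_subcover (fun z => Metric.ball z (κ * gap z))
    fun z hz => Metric.ball_mem_nhds _ (mul_pos hκ (gap_pos_iff.2 (hKs hz)))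
  set U : t → Set (ℝ × ℝ) := fun i => Metric.ball (i : ℝ × ℝ) (κ * gap i) with hUdef
  have hcov : K ⊆ ⋃ i, U i := fun z hz => by
    obtain ⟨i, hi, hzi⟩ := Set.mem_iUnion₂.1 (ht hz)
    exact Set.mem_iUnion.2 ⟨⟨i, hi⟩, hzi⟩
  obtain ⟨f, hf⟩ := PartitionOfUnity.exists_isSubordinate_of_locallyFinite hK.isClosed U
    (fun i => Metric.isOpen_ball) (locallyFinite_of_finite U) hcov
  have hsum : ∀ z, ∑ i, f i z = ∑ᶠ i, f i z := fun z => (finsum_eq_sum_of_fintype _).symm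
  have hgap : ∀ i : t, ∀ z ∈ U i, gap i / 2 ≤ gap z ∧ gap z ≤ 2 * gap i := fun i z hz => by
    have h1 := abs_le.1 (abs_gap_sub_le z i)
    have h2 : dist z i < κ * gap i := hz
    have h3 := gap_nonneg (i : ℝ × ℝ)
    constructor <;> nlinarith
  have hpos : ∀ i : t, 0 < gap (i : ℝ × ℝ) := fun i => gap_pos_iff.2 (hKs (htK i i.2))
  refine ⟨t, fun i => f i, U, fun i => (f i).continuous, fun i z => f.nonneg i z,
    fun z => ?_, fun z hz => ?_, fun i => ?_, fun i z hz => ?_, fun i z hz => ?_,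
    fun i z hz w hw => ?_, fun i => ⟨2 * gap i, fun z hz => (hgap i z hz).2⟩⟩
  · rw [hsum]; exact f.sum_le_one z
  · rw [hsum]; exact f.sum_eq_one hz
  · exact Metric.isCompact_of_isClosed_isBounded (isClosed_tsupport _)
      (Metric.isBounded_ball.subset (hf i))
  · refine gap_pos_iff.1 ?_
    linarith [(hgap i z (hf i hz)).1, hpos i]
  · exact image_eq_zero_of_notMem_tsupport fun h => hz (hf i h)
  · have h1 : dist z i < κ * gap i := hz
    have h2 : dist w i < κ * gap i := hw
    have h3 := dist_triangle_right z w i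
    have h4 := (hgap i z hz).1
    nlinarith

/-- Intermediate powers: the power `s` is controlled by `x ^ a` near `0`, by `x ^ b` near infinity and
by `x ^ r` in between, whatever the position of `r`. -/
lemma rpow_le_interpolation {a b r s : ℝ} (ha : a < s) (hb : s < b) {δ : ℝ} (hδ : 0 < δ) (hs : 0 < s) :
    ∃ C, 0 ≤ C ∧ ∀ x : ℝ, 0 ≤ x → x ^ s ≤ δ * (x ^ a + x ^ b) + C * x ^ r := by
  set η := δ ^ (1 / (s - a)) with hη
  set L := δ ^ (1 / (s - b)) with hL
  have hη0 : 0 < η := by positivity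
  have hL0 : 0 < L := by positivity
  have hηp : η ^ (s - a) = δ := by
    rw [hη, ← Real.rpow_mul hδ.le, one_div_mul_cancel (by linarith), Real.rpow_one]
  have hLp : L ^ (s - b) = δ := by
    rw [hL, ← Real.rpow_mul hδ.le, one_div_mul_cancel (by linarith), Real.rpow_one]
  refine ⟨η ^ (s - r) + L ^ (s - r), by positivity, fun x hx => ?_⟩
  rcases hx.eq_or_lt with rfl | hx
  · rw [Real.zero_rpow hs.ne']
    have h0 : ∀ c : ℝ, (0 : ℝ) ≤ 0 ^ c := fun c => Real.rpow_nonneg le_rfl c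
    have := h0 a; have := h0 b; have := h0 r
    positivity
  have hxa : 0 < x ^ a := by positivity
  have hxb : 0 < x ^ b := by positivity
  have hxr : 0 < x ^ r := by positivity
  have e : ∀ c, x ^ s = x ^ (s - c) * x ^ c := fun c => by
    rw [← Real.rpow_add hx, sub_add_cancel]
  have hC : 0 ≤ (η ^ (s - r) + L ^ (s - r)) * x ^ r := by positivity
  rcases le_total x η with h | h
  · have : x ^ (s - a) ≤ δ := by
      rw [← hηp]; exact Real.rpow_le_rpow hx.le h (by linarith)
    rw [e a]
    nlinarith
  rcases le_total L x with h' | h'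
  · have : x ^ (s - b) ≤ δ := by
      rw [← hLp]; exact Real.rpow_le_rpow_of_nonpos hL0 h' (by linarith)
    rw [e b]
    nlinarith
  · have : x ^ (s - r) ≤ η ^ (s - r) + L ^ (s - r) := by
      rcases le_total 0 (s - r) with hsr | hsr
      · have := Real.rpow_le_rpow hx.le h' hsr
        have : 0 < η ^ (s - r) := by positivity
        linarith
      · have := Real.rpow_le_rpow_of_nonpos hη0 h hsr
        have : 0 < L ^ (s - r) := by positivity
        linarith
    have h3 : 0 < δ * (x ^ a + x ^ b) := by positivity
    rw [e r]
    nlinarith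

/-- Tightness of the finite measure with density `gap ^ r` with respect to `μ`. -/
lemma exists_isCompact_energy_compl_le {r : ℝ} (hr : 0 < r) {μ : Measure (ℝ × ℝ)}
    (hμ : energy r μ < ⊤) {τ : ℝ} (hτ : 0 < τ) :
    ∃ K, IsCompact K ∧ K ⊆ halfPlane ∧
      ∀ ψ : ℝ × ℝ → ℝ, Continuous ψ → (∀ z, 0 ≤ ψ z) → (∀ z, ψ z ≤ 1) → (∀ z ∈ K, ψ z = 0) →
        ∫ z, ψ z * gap z ^ r ∂μ ≤ τ := by
  have : IsFiniteMeasure (μ.withDensity fun z => ENNReal.ofReal (gap z ^ r)) :=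
    isFiniteMeasure_withDensity hμ.ne
  obtain ⟨K, hKs, hK, hlt⟩ := measurableSet_halfPlane.exists_isCompact_sdiff_lt
    (measure_ne_top (μ.withDensity fun z => ENNReal.ofReal (gap z ^ r)) _)
    (ε := ENNReal.ofReal τ) (by simpa using hτ)
  refine ⟨K, hK, hKs, fun ψ hψ h0 h1 hψK => ?_⟩
  have hm := measurable_gap_rpow r
  rw [integral_eq_lintegral_of_nonneg_ae
    (ae_of_all _ fun z => mul_nonneg (h0 z) (Real.rpow_nonneg (gap_nonneg z) r))
    (hψ.mul (continuous_gap.rpow_const fun _ => Or.inr hr.le)).aestronglyMeasurable]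
  refine ENNReal.toReal_le_of_le_ofReal hτ.le (le_trans ?_ hlt.le)
  have hmS := measurableSet_halfPlane.diff hK.isClosed.measurableSet
  rw [withDensity_apply _ hmS, ← lintegral_indicator hmS]
  refine lintegral_mono fun z => ?_
  by_cases hz : z ∈ halfPlane \ K
  · rw [Set.indicator_of_mem hz]
    exact ENNReal.ofReal_le_ofReal
      (mul_le_of_le_one_left (Real.rpow_nonneg (gap_nonneg z) r) (h1 z))
  · rw [Set.indicator_of_notMem hz]
    have : ψ z * gap z ^ r = 0 := by
      by_cases hzh : z ∈ halfPlane
      · have : z ∈ K := by by_contra h; exact hz ⟨hzh, h⟩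
        rw [hψK z this, zero_mul]
      · rw [gap_rpow_eq_zero hr hzh, mul_zero]
    simp [this]

/-! ### Wasserstein convergence from vague convergence and convergence of the energy -/

/-- The energy of exponent `s` left outside the cells is controlled by the one of exponent `r`. -/
lemma lintegral_rest_le {a b r s δ C : ℝ} (hr : 0 < r) (hδ : 0 ≤ δ) (hC : 0 ≤ C)
    (hint : ∀ x : ℝ, 0 ≤ x → x ^ s ≤ δ * (x ^ a + x ^ b) + C * x ^ r)
    {ψ : ℝ × ℝ → ℝ} (hψ : Continuous ψ) (h0 : ∀ z, 0 ≤ ψ z) (h1 : ∀ z, ψ z ≤ 1)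
    {ν : Measure (ℝ × ℝ)} (hνa : energy a ν < ⊤) (hνb : energy b ν < ⊤)
    (hνr : energy r ν < ⊤) :
    ∫⁻ z, ENNReal.ofReal (ψ z) * ENNReal.ofReal (gap z ^ s) ∂ν ≤
      ENNReal.ofReal (δ * ((energy a ν).toReal + (energy b ν).toReal) +
        C * ∫ z, ψ z * gap z ^ r ∂ν) := by
  have hnn : ∀ (c : ℝ) z, 0 ≤ gap z ^ c := fun c z => Real.rpow_nonneg (gap_nonneg z) c
  have hI : Integrable (fun z => ψ z * gap z ^ r) ν := by
    refine (integrable_gap_rpow hνr).mono'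
      (hψ.mul (continuous_gap.rpow_const fun _ => Or.inr hr.le)).aestronglyMeasurable
      (ae_of_all _ fun z => ?_)
    rw [Real.norm_of_nonneg (mul_nonneg (h0 z) (hnn r z))]
    exact mul_le_of_le_one_left (hnn r z) (h1 z)
  have hIab : Integrable (fun z => δ * (gap z ^ a + gap z ^ b)) ν :=
    ((integrable_gap_rpow hνa).add (integrable_gap_rpow hνb)).const_mul δ
  have hsum : Integrable (fun z => δ * (gap z ^ a + gap z ^ b) + C * (ψ z * gap z ^ r)) ν :=
    hIab.add (hI.const_mul C)
  have e : δ * ((energy a ν).toReal + (energy b ν).toReal) + C * ∫ z, ψ z * gap z ^ r ∂ν =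
      ∫ z, δ * (gap z ^ a + gap z ^ b) + C * (ψ z * gap z ^ r) ∂ν := by
    rw [integral_add hIab (hI.const_mul C), integral_const_mul, integral_const_mul,
      integral_add (integrable_gap_rpow hνa) (integrable_gap_rpow hνb), integral_gap_rpow,
      integral_gap_rpow]
  rw [e, ofReal_integral_eq_lintegral_ofReal hsum (ae_of_all _ fun z => by
    have := hnn a z; have := hnn b z; have := mul_nonneg (h0 z) (hnn r z)
    simp only [Pi.zero_apply]
    positivity)]
  refine lintegral_mono fun z => ?_
  rw [← ENNReal.ofReal_mul (h0 z)]
  refine ENNReal.ofReal_le_ofReal ?_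
  have h2 := mul_le_mul_of_nonneg_left (hint _ (gap_nonneg z)) (h0 z)
  have h3 : ψ z * (δ * (gap z ^ a + gap z ^ b)) ≤ δ * (gap z ^ a + gap z ^ b) :=
    mul_le_of_le_one_left (mul_nonneg hδ (add_nonneg (hnn a z) (hnn b z))) (h1 z)
  linarith

/-- Vague convergence matches the masses of the cells, and convergence of the energy of one exponent
prevents energy from escaping outside the cells. -/
lemma tendsto_cost_of_vagueTendsto {p q C r s : ℝ} (hp : 0 < p) (hpr : p < r) (hrq : r < q)
    (hps : p < s) (hsq : s < q)
    {μn : ℕ → Measure (ℝ × ℝ)} {μ : Measure (ℝ × ℝ)}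
    (hμn : ∀ n, TailBound p q C (μn n)) (hμ : TailBound p q C μ)
    (hn0 : ∀ n, μn n halfPlaneᶜ = 0) (h0 : μ halfPlaneᶜ = 0)
    (hv : VagueTendsto μn μ)
    (hE : Tendsto (fun n => (energy r (μn n)).toReal) atTop (𝓝 (energy r μ).toReal)) :
    Tendsto (fun n => cost s (μn n) μ) atTop (𝓝 0) := by
  have hr := hp.trans hpr
  have hs := hp.trans hps
  obtain ⟨a, hpa, has⟩ := exists_between hps
  obtain ⟨b, hsb, hbq⟩ := exists_between hsq
  have ha := hp.trans hpa
  have hb := hs.trans hsb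
  obtain ⟨Mr, hMr, hEr⟩ := TailBound.exists_energy_le hp hpr hrq C
  obtain ⟨Ms, hMs, hEs⟩ := TailBound.exists_energy_le hp hps hsq C
  obtain ⟨Ma, hMa, hEa⟩ := TailBound.exists_energy_le hp hpa (has.trans hsq) C
  obtain ⟨Mb, hMb, hEb⟩ := TailBound.exists_energy_le hp (hps.trans hsb) hbq C
  refine ENNReal.tendsto_nhds_zero.2 fun ε' hε' => ?_
  obtain ⟨ε, hε0, hεε'⟩ := ENNReal.lt_iff_exists_nnreal_btwn.1 hε'
  have hε : 0 < (ε : ℝ) := by exact_mod_cast hε0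
  have hma : 0 ≤ Ma.toReal := ENNReal.toReal_nonneg
  have hmb : 0 ≤ Mb.toReal := ENNReal.toReal_nonneg
  have hms : 0 ≤ Ms.toReal := ENNReal.toReal_nonneg
  -- `κ`, the relative size of the cells, makes moving mass inside them cost at most `ε / 4`.
  set κ := min 1 (((ε : ℝ) / (8 * (Ms.toReal + 1))) ^ (1 / s)) with hκdef
  have hκ : 0 < κ := by positivity
  have hκ1 : κ ≤ 1 := min_le_left _ _
  have hκs : κ ^ s ≤ (ε : ℝ) / (8 * (Ms.toReal + 1)) := by
    calc κ ^ s ≤ (((ε : ℝ) / (8 * (Ms.toReal + 1))) ^ (1 / s)) ^ s :=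
          Real.rpow_le_rpow hκ.le (min_le_right _ _) hs.le
      _ = _ := by rw [← Real.rpow_mul (by positivity), one_div_mul_cancel hs.ne', Real.rpow_one]
  -- `δ` and `τ` make the energy outside the cells at most `ε / 8` for each of the two measures.
  set δ := (ε : ℝ) / (16 * (Ma.toReal + Mb.toReal + 1)) with hδdef
  have hδ : 0 < δ := by positivity
  have hδM : δ * (Ma.toReal + Mb.toReal) ≤ ε / 16 := by
    rw [hδdef, div_mul_eq_mul_div, div_le_div_iff₀ (by positivity) (by norm_num)]
    nlinarith
  obtain ⟨A, hA, hint⟩ := rpow_le_interpolation (r := r) has hsb hδ hs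
  set τ := (ε : ℝ) / (32 * (A + 1)) with hτdef
  have hτ : 0 < τ := by positivity
  have hAτ : A * (2 * τ) ≤ ε / 16 := by
    rw [hτdef, mul_div_assoc', mul_div_assoc', div_le_div_iff₀ (by positivity) (by norm_num)]
    nlinarith
  obtain ⟨K, hK, hKs, hKτ⟩ := exists_isCompact_energy_compl_le hr ((hEr μ hμ).trans_lt hMr.lt_top) hτ
  obtain ⟨t, φ, U, hφc, hφ0, hφ1, hφK, hφs, hφh, hφU, hU, hG⟩ :=
    exists_partition (κ := κ / 4) (by positivity) (by linarith) hK hKs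
  choose G hG using hG
  have hψc : Continuous fun z => 1 - ∑ i, φ i z := by fun_prop
  have hψ0 : ∀ z, 0 ≤ 1 - ∑ i, φ i z := fun z => by linarith [hφ1 z]
  have hψ1 : ∀ z, 1 - ∑ i, φ i z ≤ 1 := fun z => by
    linarith [Finset.sum_nonneg fun i (_ : i ∈ Finset.univ) => hφ0 i z]
  have hφint : ∀ i (ν : Measure (ℝ × ℝ)), TailBound p q C ν → Integrable (φ i) ν :=
    fun i ν hν => (energyControlled_of_hasCompactSupport hr (hφc i) (hφs i) (hφh i)).integrable hr
      (hφc i).measurable (eq_zero_of_notMem_halfPlane (hφh i)) ((hEr ν hν).trans_lt hMr.lt_top)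
  have hφlint : ∀ i (ν : Measure (ℝ × ℝ)), TailBound p q C ν →
      ∫⁻ z, ENNReal.ofReal (φ i z) ∂ν = ENNReal.ofReal (∫ z, φ i z ∂ν) := fun i ν hν =>
    (ofReal_integral_eq_lintegral_ofReal (hφint i ν hν) (ae_of_all _ (hφ0 i))).symm
  -- The surplus masses in the cells vanish in the limit.
  have hcells : Tendsto (fun n => ∑ i, ENNReal.ofReal (G i ^ s) *
        ((∫⁻ z, ENNReal.ofReal (φ i z) ∂(μn n) - ∫⁻ z, ENNReal.ofReal (φ i z) ∂μ) +
          (∫⁻ z, ENNReal.ofReal (φ i z) ∂μ - ∫⁻ z, ENNReal.ofReal (φ i z) ∂(μn n))))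
      atTop (𝓝 0) := by
    rw [← Finset.sum_const_zero (s := (Finset.univ : Finset t))]
    refine tendsto_finsetSum _ fun i _ => ?_
    have h1 : Tendsto (fun n => ∫⁻ z, ENNReal.ofReal (φ i z) ∂(μn n)) atTop
        (𝓝 (∫⁻ z, ENNReal.ofReal (φ i z) ∂μ)) := by
      rw [hφlint i μ hμ]
      simp_rw [fun n => hφlint i (μn n) (hμn n)]
      exact ENNReal.tendsto_ofReal (hv _ (hφc i) (hφs i) (hφh i))
    have hfin : ∫⁻ z, ENNReal.ofReal (φ i z) ∂μ ≠ ⊤ := by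
      rw [hφlint i μ hμ]; exact ENNReal.ofReal_ne_top
    have h2 := ENNReal.Tendsto.sub h1 (tendsto_const_nhds (x := ∫⁻ z, ENNReal.ofReal (φ i z) ∂μ))
      (Or.inl hfin)
    have h3 := ENNReal.Tendsto.sub (tendsto_const_nhds (x := ∫⁻ z, ENNReal.ofReal (φ i z) ∂μ)) h1
      (Or.inl hfin)
    have h4 := ENNReal.Tendsto.const_mul (a := ENNReal.ofReal (G i ^ s)) (h2.add h3)
      (Or.inr ENNReal.ofReal_ne_top)
    simpa using h4
  -- The energy outside the cells is the total energy minus integrals of test functions.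
  have hJ : ∀ ν : Measure (ℝ × ℝ), TailBound p q C ν → ∫ z, (1 - ∑ i, φ i z) * gap z ^ r ∂ν =
      (energy r ν).toReal - ∑ i, ∫ z, φ i z * gap z ^ r ∂ν := fun ν hν => by
    have hg := integrable_gap_rpow ((hEr ν hν).trans_lt hMr.lt_top)
    have hgi : ∀ i, Integrable (fun z => φ i z * gap z ^ r) ν := fun i => by
      refine hg.mono' ((hφc i).mul
        (continuous_gap.rpow_const fun _ => Or.inr hr.le)).aestronglyMeasurable
        (ae_of_all _ fun z => ?_)
      have hz := Real.rpow_nonneg (gap_nonneg z) r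
      rw [Real.norm_of_nonneg (mul_nonneg (hφ0 i z) hz)]
      exact mul_le_of_le_one_left hz ((Finset.single_le_sum (fun j _ => hφ0 j z)
        (Finset.mem_univ i)).trans (hφ1 z))
    simp_rw [sub_mul, one_mul, Finset.sum_mul]
    rw [integral_sub hg (integrable_finsetSum _ fun i _ => hgi i), integral_finsetSum _
      fun i _ => hgi i, integral_gap_rpow]
  have hJlim : Tendsto (fun n => ∫ z, (1 - ∑ i, φ i z) * gap z ^ r ∂(μn n)) atTop
      (𝓝 (∫ z, (1 - ∑ i, φ i z) * gap z ^ r ∂μ)) := by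
    rw [hJ μ hμ]
    simp_rw [fun n => hJ (μn n) (hμn n)]
    refine hE.sub (tendsto_finsetSum _ fun i _ => ?_)
    exact hv _ ((hφc i).mul (continuous_gap.rpow_const fun _ => Or.inr hr.le)) (hφs i).mul_right
      ((tsupport_mul_subset_left).trans (hφh i))
  have hJμ : ∫ z, (1 - ∑ i, φ i z) * gap z ^ r ∂μ ≤ τ :=
    hKτ _ hψc hψ0 hψ1 fun z hz => by rw [hφK z hz, sub_self]
  have hrest : ∀ ν : Measure (ℝ × ℝ), TailBound p q C ν →
      ∫ z, (1 - ∑ i, φ i z) * gap z ^ r ∂ν ≤ 2 * τ →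
      ∫⁻ z, ENNReal.ofReal (1 - ∑ i, φ i z) * ENNReal.ofReal (gap z ^ s) ∂ν ≤
        ENNReal.ofReal (ε / 8) := fun ν hν hle => by
    refine (lintegral_rest_le hr hδ.le hA hint hψc hψ0 hψ1 ((hEa ν hν).trans_lt hMa.lt_top)
      ((hEb ν hν).trans_lt hMb.lt_top) ((hEr ν hν).trans_lt hMr.lt_top)).trans
      (ENNReal.ofReal_le_ofReal ?_)
    have h1 := ENNReal.toReal_mono hMa (hEa ν hν)
    have h2 := ENNReal.toReal_mono hMb (hEb ν hν)
    have h3 := mul_le_mul_of_nonneg_left (add_le_add h1 h2) hδ.le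
    have h4 := mul_le_mul_of_nonneg_left hle hA
    linarith
  have hcell0 : (0 : ENNReal) < ENNReal.ofReal (ε / 4) := by simpa using hε
  filter_upwards [ENNReal.tendsto_nhds_zero.1 hcells _ hcell0,
    (tendsto_order.1 hJlim).2 (2 * τ) (by linarith)] with n hn1 hn2
  refine le_trans ?_ hεε'.le
  refine (cost_le_of_partition (κ := κ) (B := fun i => G i ^ s) hs hκ.le hφc hφ0 hφ1 hφU
    (fun i z hz w hw => by have := hU i z hz w hw; rwa [mul_div_cancel₀ _ (by norm_num)] at this)
    (fun i z hz => Real.rpow_le_rpow (gap_nonneg z) (hG i z hz) hs.le) (hn0 n) h0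
    (fun i => by rw [hφlint i _ (hμn n)]; exact ENNReal.ofReal_ne_top)
    (fun i => by rw [hφlint i _ hμ]; exact ENNReal.ofReal_ne_top)).trans ?_
  have hMs' : ENNReal.ofReal (κ ^ s) * (energy s (μn n) + energy s μ) ≤ ENNReal.ofReal (ε / 4) := by
    calc _ ≤ ENNReal.ofReal ((ε : ℝ) / (8 * (Ms.toReal + 1))) *
          (ENNReal.ofReal Ms.toReal + ENNReal.ofReal Ms.toReal) := by
          rw [ENNReal.ofReal_toReal hMs]
          gcongr
          · exact hEs _ (hμn n)
          · exact hEs _ hμ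
      _ = ENNReal.ofReal ((ε : ℝ) / (8 * (Ms.toReal + 1)) * (Ms.toReal + Ms.toReal)) := by
          rw [← ENNReal.ofReal_add hms hms, ← ENNReal.ofReal_mul (by positivity)]
      _ ≤ _ := by
          refine ENNReal.ofReal_le_ofReal ?_
          rw [div_mul_eq_mul_div, div_le_div_iff₀ (by positivity) (by norm_num)]
          nlinarith
  calc _ ≤ ENNReal.ofReal ((ε : ℝ) / 4) + ENNReal.ofReal ((ε : ℝ) / 4) +
        (ENNReal.ofReal ((ε : ℝ) / 8) + ENNReal.ofReal ((ε : ℝ) / 8)) := by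
        gcongr
        · exact hrest _ (hμn n) hn2.le
        · exact hrest _ hμ (by linarith)
    _ = ENNReal.ofReal ((ε : ℝ) / 4 + ε / 4 + (ε / 8 + ε / 8)) := by
        rw [ENNReal.ofReal_add (by positivity) (by positivity),
          ENNReal.ofReal_add (by positivity) (by positivity),
          ENNReal.ofReal_add (by positivity) (by positivity)]
    _ ≤ ENNReal.ofReal ε := ENNReal.ofReal_le_ofReal (by linarith)
    _ = ε := ENNReal.ofReal_coe_nnreal

end Persistence

theorem mainTheorem3 (p q : ℝ) (hp : 0 < p) (hpq : p < q)
    (μn : ℕ → Measure (ℝ × ℝ)) (μ : Measure (ℝ × ℝ))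
    (hμn : ∀ n, μn n ∈ Persistence.persistenceSpace p ∩ Persistence.persistenceSpace q)
    (hμ : μ ∈ Persistence.persistenceSpace p ∩ Persistence.persistenceSpace q)
    (g : ℝ → ℝ) (hg : ∀ ε, 0 < ε → 0 ≤ g ε)
    (hbound : ∀ n ε, 0 < ε → μn n (Persistence.tail ε) ≤ ENNReal.ofReal (g ε))
    (hg_zero : g =O[𝓝[>] (0 : ℝ)] fun ε => ε ^ (-p))
    (hg_top : g =O[atTop] fun ε => ε ^ (-q)) :
    List.TFAE [
      ∃ r : ℝ, p < r ∧ r < q ∧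
        Tendsto (fun n => Persistence.wassersteinDist r (μn n) μ) atTop (𝓝 0),
      ∃ r : ℝ, p < r ∧ r < q ∧ Persistence.VagueTendsto μn μ ∧
        Tendsto (fun n => Persistence.zeta (μn n) (r : ℂ)) atTop
          (𝓝 (Persistence.zeta μ (r : ℂ))),
      ∀ᵐ w : ℝ × ℝ, 0 < w.2 →
        Tendsto (fun n => μn n (Persistence.tail w.2)) atTop (𝓝 (μ (Persistence.tail w.2))) ∧
        Tendsto (fun n => μn n (Persistence.quadrant w.1 w.2)) atTop
          (𝓝 (μ (Persistence.quadrant w.1 w.2))),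
      ∀ᵐ x : ℝ, ∀ K : Set ℂ, IsCompact K → K ⊆ Persistence.strip p q →
        TendstoUniformlyOn (fun n => Persistence.localZeta (μn n) x)
          (Persistence.localZeta μ x) atTop K ∧
        TendstoUniformlyOn (fun n => Persistence.zeta (μn n)) (Persistence.zeta μ) atTop K,
      ∀ r : ℝ, p < r → r < q →
        Tendsto (fun n => Persistence.wassersteinDist r (μn n) μ) atTop (𝓝 0)] := by
  open Persistence in
  obtain ⟨C₁, h₁⟩ := TailBound.of_isBigO hp hpq hg_zero hg_top
  obtain ⟨C₂, h₂⟩ := TailBound.of_mem hp hpq hμ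
  -- A common nonnegative constant for all the tail bounds.
  set C := max 0 (max C₁ C₂) with hCdef
  have hC : 0 ≤ C := le_max_left _ _
  have hbn : ∀ n, TailBound p q C (μn n) := fun n =>
    (h₁ (μn n) (hbound n)).mono ((le_max_left _ _).trans (le_max_right _ _))
  have hb : TailBound p q C μ := h₂.mono ((le_max_right _ _).trans (le_max_right _ _))
  have hn0 : ∀ n, μn n halfPlaneᶜ = 0 := fun n => (hμn n).1.1
  have h0 : μ halfPlaneᶜ = 0 := hμ.1.1
  have hzeta : ∀ r, p < r → (Tendsto (fun n => zeta (μn n) (r : ℂ)) atTop (𝓝 (zeta μ (r : ℂ))) ↔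
      Tendsto (fun n => (energy r (μn n)).toReal) atTop (𝓝 (energy r μ).toReal)) := fun r hr => by
    simp_rw [zeta_ofReal hp hr hb, fun n => zeta_ofReal hp hr (hbn n)]
    exact Complex.isometry_ofReal.isEmbedding.tendsto_nhds_iff.symm
  tfae_have 1 → 2 := by
    rintro ⟨r, hpr, hrq, h⟩
    obtain ⟨M, hM, hE⟩ := TailBound.exists_energy_le hp hpr hrq C
    have hr := hp.trans hpr
    have hc := (tendsto_cost_iff hr μn μ).1 h
    exact ⟨r, hpr, hrq, vagueTendsto_of_tendsto_cost hr hM (fun n => hE _ (hbn n)) (hE _ hb) hc,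
      (hzeta r hpr).2
        (tendsto_energy_of_tendsto_cost hr hM (fun n => hE _ (hbn n)) (hE _ hb) hc)⟩
  tfae_have 2 → 5 := by
    rintro ⟨r, hpr, hrq, hv, hz⟩ s hps hsq
    exact (tendsto_cost_iff (hp.trans hps) μn μ).2
      (tendsto_cost_of_vagueTendsto hp hpr hrq hps hsq hbn hb hn0 h0 hv ((hzeta r hpr).1 hz))
  tfae_have 5 → 1 := fun h => by
    obtain ⟨r, hpr, hrq⟩ := exists_between hpq
    exact ⟨r, hpr, hrq, h r hpr hrq⟩
  tfae_have 1 → 3 := by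
    rintro ⟨r, hpr, -, h⟩
    have hr := hp.trans hpr
    exact ae_tendsto_of_tendsto_cost hr hb h0 ((tendsto_cost_iff hr μn μ).1 h)
  tfae_have 3 → 4 := tendstoUniformlyOn_zeta_of_ae hpq hC hbn hb
  tfae_have 4 → 2 := fun h => by
    obtain ⟨r, hpr, hrq⟩ := exists_between hpq
    have hsub : ∀ s : ℂ, s.re = r → {s} ⊆ strip p q := fun s hs => by
      rintro _ rfl
      exact ⟨hs ▸ hpr, hs ▸ hrq⟩
    refine ⟨r, hpr, hrq, vagueTendsto_of_tendsto_localZeta hp hpr hrq hC hbn hb ?_, ?_⟩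
    · filter_upwards [h] with x hx s hs
      exact ((hx {s} isCompact_singleton (hsub s hs)).1).tendsto_at rfl
    · obtain ⟨x, hx⟩ := h.exists
      exact ((hx {(r : ℂ)} isCompact_singleton (hsub r (Complex.ofReal_re r))).2).tendsto_at rfl
  tfae_finish
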